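/- In the Penalized Knapsack Problem (PKP) we are given $n$ items with non-negative integer profits $p_j$, weights $w_j$ and penalties $\pi_j$ ($j=1,\dots,n$) and a knapsack capacity $c\in\mathbb{Z}_{\ge 0}$. A set $S\subseteq\{1,\dots,n\}$ is feasible if $\sum_{j\in S} w_j\le c$; its value is $\sum_{j\in S}p_j-\max_{j\in S}\pi_j$, where the maximum over the empty set is $0$. The largest value of a feasible set is denoted by $z^*$. For $0<\delta<1$ let $A(\delta)$ be the following algorithm. Arrange the items so that $\pi_1\ge\dots\ge\pi_n$. For each item $j$ with $w_j\le c$ (the leading item), compute with a $(1-\delta)$-approximation algorithm for the ordinary 0–1 knapsack problem a set $T_j$ for the items $\{j+1,\dots,n\}$ and the capacity $c-w_j$, that is, a set $T_j\subseteq\{j+1,\dots,n\}$ with weight at most $c-w_j$ and profit at least $(1-\delta)$ times the optimum $z^R_j$ of this knapsack problem. Output a set of greatest PKP value among $\emptyset$ and the sets $\{j\}\cup T_j$. **Proposition.** Let $C\ge 0$ be a constant, and consider the instances of PKP with $\pi_j-p_j\le C$ for all $j$. 1. For every such instance and every $0<\varepsilon<1$, every set $S$ that $A(\delta)$ with $\delta=\varepsilon/(C+1)$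 can output, whichever $(1-\delta)$-approximate knapsack solutions $T_j$ it uses, is feasible and has value at least $(1-\varepsilon)z^*$. 2. There is a program (for a random access machine with logarithmic cost), depending only on $C$, that is an FPTAS for PKP on these instances and realizes $A(\varepsilon/(C+1))$: for every such instance and every $0<\varepsilon<1$, given the instance and the integer $\lceil 1/\varepsilon\rceil$, it halts after a time that is bounded by a polynomial (depending only on $C$) in the encoding length of the instance and $1/\varepsilon$, and outputs a feasible set of value at least $(1-\varepsilon)z^*$, which is a possible output of $A(\varepsilon/(C+1))$ on that instance. -/

import Mathlib

namespace PKP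

/-! ## The penalized knapsack problem -/

/-- An instance of the 0--1 Penalized Knapsack Problem: `n` items with profit `p j`, weight `w j`
and penalty `pen j`, and a knapsack of capacity `c`; all data are non-negative integers.
The items may be listed in any order. -/
structure Instance where
  n : ℕ
  c : ℕ
  p : Fin n → ℕ
  w : Fin n → ℕ
  pen : Fin n → ℕ

namespace Instance

variable (I : Instance)

/-- `S` fits into the knapsack. -/
def Feasible (S : Finset (Fin I.n)) : Prop := ∑ j ∈ S, I.w j ≤ I.c

instance : DecidablePred I.Feasible := fun S =>
  inferInstanceAs (Decidable (∑ j ∈ S, I.w j ≤ I.c))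

/-- Total profit minus the greatest penalty of a packed item (which is `0` if nothing is packed). -/
def value (S : Finset (Fin I.n)) : ℤ := (∑ j ∈ S, (I.p j : ℤ)) - ((S.sup I.pen : ℕ) : ℤ)

theorem feasible_nonempty :
    ((Finset.univ : Finset (Finset (Fin I.n))).filter I.Feasible).Nonempty :=
  ⟨∅, by simp [Feasible]⟩

/-- The optimal objective value `z*`. -/
def opt : ℤ :=
  ((Finset.univ : Finset (Finset (Fin I.n))).filter I.Feasible).sup' I.feasible_nonempty I.value

/-- `T` is a feasible solution of the ordinary 0--1 knapsack problem with the given item set and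
capacity (profits and weights as in `I`). -/
def KPFeasible (items : Finset (Fin I.n)) (cap : ℕ) (T : Finset (Fin I.n)) : Prop :=
  T ⊆ items ∧ ∑ j ∈ T, I.w j ≤ cap

/-- The optimal value of that knapsack problem. -/
def kpOpt (items : Finset (Fin I.n)) (cap : ℕ) : ℕ :=
  (items.powerset.filter fun T => ∑ j ∈ T, I.w j ≤ cap).sup fun T => ∑ j ∈ T, I.p j

/-- The items that come after `j` when the items are arranged by non-increasing penalty (items of
equal penalty staying in the given order). If the given order is already of this kind, these are
the items `j + 1, …, n`: see `rest_eq_of_antitone`. -/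
def rest (j : Fin I.n) : Finset (Fin I.n) :=
  Finset.univ.filter fun i => I.pen i < I.pen j ∨ (I.pen i = I.pen j ∧ j < i)

theorem rest_eq_of_antitone (h : Antitone I.pen) (j : Fin I.n) : I.rest j = Finset.Ioi j := by
  ext i
  simp only [rest, Finset.mem_filter, Finset.mem_univ, true_and, Finset.mem_Ioi]
  constructor
  · rintro (h1 | h1)
    · by_contra h2
      exact absurd (h (not_lt.mp h2)) (not_le.mpr h1)
    · exact h1.2
  · intro h1
    rcases (h h1.le).lt_or_eq with h2 | h2
    · exact Or.inl h2
    · exact Or.inr ⟨h2, h1⟩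

/-- The solutions among which algorithm `A(δ)` selects: the empty set and, for each item `j` that
fits into the knapsack, the leading item `j` together with the set `T j`. -/
def candidates (T : Fin I.n → Finset (Fin I.n)) : Finset (Finset (Fin I.n)) :=
  insert ∅ ((Finset.univ.filter fun j => I.w j ≤ I.c).image fun j => insert j (T j))

/-- `S` is a possible result of algorithm `A(δ)` on `I`. For each choice of the leading item `j`
(with `w j ≤ c`), a `(1 - δ)`-approximate solution `T j` is computed of the ordinary knapsack
problem with capacity `c - w j` on the items after `j`; the result is a best one among the sets
`{j} ∪ T j` and the empty set. The choice of the `(1 - δ)`-approximation algorithm for knapsack,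
hence of the sets `T j`, and of the best candidate in case of ties, is left open. -/
def IsResultOfA (δ : ℝ) (S : Finset (Fin I.n)) : Prop :=
  ∃ T : Fin I.n → Finset (Fin I.n),
    (∀ j, I.w j ≤ I.c →
      I.KPFeasible (I.rest j) (I.c - I.w j) (T j) ∧
      (1 - δ) * (I.kpOpt (I.rest j) (I.c - I.w j) : ℝ) ≤ ∑ i ∈ T j, (I.p i : ℝ)) ∧
    S ∈ I.candidates T ∧ ∀ S' ∈ I.candidates T, I.value S' ≤ I.value S

/-- The number of bits of the encoding of `I` (binary numbers, each with a separator). -/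
def length : ℕ :=
  (I.c.size + 1) + ∑ j, ((I.p j).size + 1 + ((I.w j).size + 1) + ((I.pen j).size + 1))

/-- The difference between penalty and profit of every item is at most `C`. -/
def PenaltyExcessLE (C : ℝ) : Prop := ∀ j, (I.pen j : ℝ) - (I.p j : ℝ) ≤ C

end Instance

/-! ## The machine model: random access machines with logarithmic cost

A program is a while-program over numbered arrays of natural numbers (a given program mentions only
finitely many of them); scalar variables are arrays used at one index only. Every operation is
charged with the bit lengths of the numbers (indices and values) that it handles, so that time is
polynomially related to the running time of Turing machines. -/

/-- The memory: cell `i` of array `a` holds `M a i`. -/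
abbrev Memory := ℕ → ℕ → ℕ

/-- Arithmetic operations of the machine. -/
inductive Op where
  | add
  | sub
  | mul
  | div

/-- Subtraction is truncated at `0`; division rounds down, and division by `0` gives `0`. -/
def Op.eval : Op → ℕ → ℕ → ℕ
  | .add, x, y => x + y
  | .sub, x, y => x - y
  | .mul, x, y => x * y
  | .div, x, y => x / y

/-- Expressions: constants, array cells, arithmetic. -/
inductive Expr where
  | lit (k : ℕ)
  | get (a : ℕ) (i : Expr)
  | op (o : Op) (e₁ e₂ : Expr)

def Expr.eval (M : Memory) : Expr → ℕ
  | .lit k => k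
  | .get a i => M a (i.eval M)
  | .op o e₁ e₂ => o.eval (e₁.eval M) (e₂.eval M)

/-- Time for evaluating an expression. -/
def Expr.cost (M : Memory) : Expr → ℕ
  | .lit k => 1 + k.size
  | .get a i => i.cost M + (1 + (i.eval M).size + (M a (i.eval M)).size)
  | .op _ e₁ e₂ => e₁.cost M + e₂.cost M + (1 + (e₁.eval M).size + (e₂.eval M).size)

/-- Programs. `store a i e` writes the value of `e` into cell `i` of array `a`; tests ask whether
the value of an expression is nonzero; `loop e P` repeats `P` while the value of `e` is nonzero. -/
inductive Prog where
  | skip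
  | store (a : ℕ) (i e : Expr)
  | seq (P Q : Prog)
  | branch (e : Expr) (P Q : Prog)
  | loop (e : Expr) (P : Prog)

/-- The memory after writing `v` into cell `i` of array `a`. -/
def Memory.write (M : Memory) (a i v : ℕ) : Memory :=
  Function.update M a (Function.update (M a) i v)

/-- `Exec P M t M'`: program `P`, started with memory `M`, halts after time `t` with memory `M'`. -/
inductive Exec : Prog → Memory → ℕ → Memory → Prop where
  | skip (M : Memory) : Exec .skip M 1 M
  | store (M : Memory) (a : ℕ) (i e : Expr) :
      Exec (.store a i e) M
        (i.cost M + e.cost M + (1 + (i.eval M).size + (e.eval M).size))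
        (M.write a (i.eval M) (e.eval M))
  | seq {P Q : Prog} {M M₁ M₂ : Memory} {t₁ t₂ : ℕ} :
      Exec P M t₁ M₁ → Exec Q M₁ t₂ M₂ → Exec (.seq P Q) M (t₁ + t₂) M₂
  | branch_true {e : Expr} {P Q : Prog} {M M₁ : Memory} {t : ℕ} :
      e.eval M ≠ 0 → Exec P M t M₁ → Exec (.branch e P Q) M (e.cost M + 1 + t) M₁
  | branch_false {e : Expr} {P Q : Prog} {M M₁ : Memory} {t : ℕ} :
      e.eval M = 0 → Exec Q M t M₁ → Exec (.branch e P Q) M (e.cost M + 1 + t) M₁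
  | loop_true {e : Expr} {P : Prog} {M M₁ M₂ : Memory} {t₁ t₂ : ℕ} :
      e.eval M ≠ 0 → Exec P M t₁ M₁ → Exec (.loop e P) M₁ t₂ M₂ →
      Exec (.loop e P) M (e.cost M + 1 + t₁ + t₂) M₂
  | loop_false {e : Expr} {P : Prog} {M : Memory} :
      e.eval M = 0 → Exec (.loop e P) M (e.cost M + 1) M

/-- Programs are deterministic. -/
theorem Exec.det {P : Prog} {M M₁ M₂ : Memory} {t₁ t₂ : ℕ}
    (h₁ : Exec P M t₁ M₁) (h₂ : Exec P M t₂ M₂) : t₁ = t₂ ∧ M₁ = M₂ := by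
  induction h₁ generalizing t₂ M₂ with
  | skip => cases h₂; exact ⟨rfl, rfl⟩
  | store => cases h₂; exact ⟨rfl, rfl⟩
  | seq _ _ ih ih' =>
    cases h₂ with
    | seq a b =>
      obtain ⟨rfl, rfl⟩ := ih a
      obtain ⟨rfl, rfl⟩ := ih' b
      exact ⟨rfl, rfl⟩
  | branch_true h _ ih =>
    cases h₂ with
    | branch_true _ a => obtain ⟨rfl, rfl⟩ := ih a; exact ⟨rfl, rfl⟩
    | branch_false h' _ => exact absurd h' h
  | branch_false h _ ih =>
    cases h₂ with
    | branch_true h' _ => exact absurd h h'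
    | branch_false _ a => obtain ⟨rfl, rfl⟩ := ih a; exact ⟨rfl, rfl⟩
  | loop_true h _ _ ih ih' =>
    cases h₂ with
    | loop_true _ a b =>
      obtain ⟨rfl, rfl⟩ := ih a
      obtain ⟨rfl, rfl⟩ := ih' b
      exact ⟨rfl, rfl⟩
    | loop_false h' => exact absurd h' h
  | loop_false h =>
    cases h₂ with
    | loop_true h' _ _ => exact absurd h h'
    | loop_false _ => exact ⟨rfl, rfl⟩

/-! ## Fully polynomial time approximation schemes -/

/-- The content of an array that holds the vector `f` (and `0` after it). -/
def vecArray {n : ℕ} (f : Fin n → ℕ) (i : ℕ) : ℕ := if h : i < n then f ⟨i, h⟩ else 0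

/-- The initial memory: array `0` holds `n`, `c` and the accuracy parameter `k`; arrays `1`, `2`
and `3` hold the profits, the weights and the penalties; all other cells hold `0`. -/
def inputMemory (I : Instance) (k : ℕ) : Memory := fun a =>
  match a with
  | 0 => vecArray ![I.n, I.c, k]
  | 1 => vecArray I.p
  | 2 => vecArray I.w
  | 3 => vecArray I.pen
  | _ => fun _ => 0

/-- Program `P`, started on the instance `I` and the accuracy parameter `k`, halts after time `t`
and outputs the set `S`, as its characteristic vector in cells `0, …, n - 1` of array `4`. -/
def Outputs (P : Prog) (I : Instance) (k : ℕ) (t : ℕ) (S : Finset (Fin I.n)) : Prop :=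
  ∃ M, Exec P (inputMemory I k) t M ∧ ∀ j : Fin I.n, M 4 (j : ℕ) = if j ∈ S then 1 else 0

/-- Program `P` is a fully polynomial time approximation scheme for PKP on the class `cls` of
instances: for each `0 < ε < 1` (handed over to the program as the integer `⌈1 / ε⌉`) it outputs a
feasible solution of value at least `(1 - ε) z*`, in time polynomial in the encoding length of the
instance and in `1 / ε`. (Both are at least `1`, so that each polynomial in the two is bounded by
some `a * (length + 1 / ε) ^ d`.) -/
def IsFPTAS (P : Prog) (cls : Instance → Prop) : Prop :=
  ∃ a d : ℕ, ∀ I : Instance, cls I → ∀ ε : ℝ, 0 < ε → ε < 1 →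
    ∃ (t : ℕ) (S : Finset (Fin I.n)), Outputs P I ⌈1 / ε⌉₊ t S ∧
      (t : ℝ) ≤ a * ((I.length : ℝ) + 1 / ε) ^ d ∧
      I.Feasible S ∧ (1 - ε) * (I.opt : ℝ) ≤ (I.value S : ℝ)

end PKP

namespace PKP

/-! ## Total correctness with a structural time bound -/

/-! Approximation. In a nonempty optimal set let `j` be the item that comes first in the order by
penalty. Its penalty is the one that is paid, so z* = p_j + z^R_j - π_j, and the candidate of `A(δ)`
with leading item `j` loses at most δ z^R_j. Since π_j - p_j ≤ C, we have z^R_j ≤ z* + C. Either z*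
= 0 and the empty set suffices, or integrality gives z* ≥ 1 and z^R_j ≤ (C + 1) z*. With δ = ε / (C
+ 1) the loss is at most ε z* (`IsResultOfA.approx`).

Knapsack subroutine. Let K = ⌈1/ε⌉ (⌈C⌉ + 1), so that 1 / K ≤ δ. Let m be the greatest profit of an
item that comes after `j` and fits together with it. Profits are rounded down to multiples of m / (n
K), and a dynamic program finds the least weight for each scaled profit up to n · n K. Rounding
costs at most m / K in total, and m ≤ z^R_j because a single such item is a feasible solution
(`Data.exists_solution`). To avoid storing sets, a table entry is one number whose digits are
weight, profit and characteristic vector of a set. Such codes are additive, and comparing them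
compares weights first (`Data.sum_code_lt_iff`).

Program. `WP` combines total correctness with a time bound read off the syntax: if every loop makes
at most `U` rounds and all cells have at most `b` bits, the time is at most a polynomial in `U`
times `b` (`Prog.bound_le`). Both `U` and `b` are polynomial in the encoding length and 1/ε
(`exists_time_bound`). Determinism carries the statement from one run to every run
(`Outputs.unique`). -/

instance : Add Expr := ⟨.op .add⟩
instance : Sub Expr := ⟨.op .sub⟩
instance : Mul Expr := ⟨.op .mul⟩
instance : Div Expr := ⟨.op .div⟩
instance (k : ℕ) : OfNat Expr k := ⟨.lit k⟩

namespace Expr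

/-- The scalar variable kept in cell `0` of array `a`. -/
def scalar (a : ℕ) : Expr := .get a (.lit 0)

/-- The remainder of `e₁` modulo `e₂`. -/
def rem (e₁ e₂ : Expr) : Expr := e₁ - e₂ * (e₁ / e₂)

variable (M : Memory)

@[simp] theorem eval_lit (k : ℕ) : (lit k).eval M = k := rfl
@[simp] theorem eval_zero : (0 : Expr).eval M = 0 := rfl
@[simp] theorem eval_one : (1 : Expr).eval M = 1 := rfl
@[simp] theorem eval_two : (2 : Expr).eval M = 2 := rfl
@[simp] theorem eval_get (a : ℕ) (i : Expr) : (get a i).eval M = M a (i.eval M) := rfl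
@[simp] theorem eval_scalar (a : ℕ) : (scalar a).eval M = M a 0 := rfl
@[simp] theorem eval_add (e f : Expr) : (e + f).eval M = e.eval M + f.eval M := rfl
@[simp] theorem eval_sub (e f : Expr) : (e - f).eval M = e.eval M - f.eval M := rfl
@[simp] theorem eval_mul (e f : Expr) : (e * f).eval M = e.eval M * f.eval M := rfl
@[simp] theorem eval_div (e f : Expr) : (e / f).eval M = e.eval M / f.eval M := rfl
@[simp] theorem eval_rem (e f : Expr) : (rem e f).eval M = e.eval M % f.eval M := by
  simp [rem, Nat.mod_def]

/-- The value of `e` has at most `b * e.sizeWeight` bits if all cells have at most `b` bits. -/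
def sizeWeight : Expr → ℕ
  | .lit k => k.size
  | .get _ _ => 1
  | .op _ e₁ e₂ => e₁.sizeWeight + e₂.sizeWeight + 1

/-- Evaluating `e` takes at most time `b * e.costWeight` if all cells have at most `b` bits. -/
def costWeight : Expr → ℕ
  | .lit k => 1 + k.size
  | .get _ i => i.costWeight + (2 + i.sizeWeight)
  | .op _ e₁ e₂ => e₁.costWeight + e₂.costWeight + (1 + e₁.sizeWeight + e₂.sizeWeight)

end Expr

/-- All cells of the memory hold numbers with at most `b` bits. -/
def Memory.Bounded (b : ℕ) (M : Memory) : Prop := ∀ a i, M a i < 2 ^ b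

theorem Memory.write_apply (M : Memory) (a i v a' i' : ℕ) :
    M.write a i v a' i' = if a' = a ∧ i' = i then v else M a' i' := by
  unfold Memory.write
  by_cases h : a' = a
  · subst h
    by_cases h' : i' = i <;> simp [h']
  · simp [h]

theorem Memory.write_of_ne (M : Memory) {a i v a' : ℕ} (h : a' ≠ a) :
    M.write a i v a' = M a' := by
  simp [Memory.write, h]

theorem Memory.Bounded.write {b : ℕ} {M : Memory} (hM : M.Bounded b) (a i : ℕ) {v : ℕ}
    (hv : v < 2 ^ b) : (M.write a i v).Bounded b := by
  intro a' i'
  rw [Memory.write_apply]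
  split_ifs
  · exact hv
  · exact hM a' i'

theorem Op.size_eval_le (o : Op) (x y : ℕ) : (o.eval x y).size ≤ x.size + y.size + 1 := by
  have hx := Nat.lt_size_self x
  have hy := Nat.lt_size_self y
  cases o
  · refine Nat.size_le.2 ?_
    have h1 : 2 ^ x.size ≤ 2 ^ (x.size + y.size) := Nat.pow_le_pow_right two_pos (by omega)
    have h2 : 2 ^ y.size ≤ 2 ^ (x.size + y.size) := Nat.pow_le_pow_right two_pos (by omega)
    simp only [Op.eval, pow_succ]
    omega
  · have := Nat.size_le_size (Nat.sub_le x y)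
    simp only [Op.eval]
    omega
  · refine (Nat.size_le.2 ?_ : _ ≤ x.size + y.size).trans (by omega)
    simp only [Op.eval, pow_add]
    exact Nat.mul_lt_mul'' hx hy
  · have := Nat.size_le_size (Nat.div_le_self x y)
    simp only [Op.eval]
    omega

theorem Expr.size_eval_le {b : ℕ} (hb : 1 ≤ b) {M : Memory} (hM : M.Bounded b) (e : Expr) :
    (e.eval M).size ≤ e.sizeWeight * b := by
  induction e with
  | lit k => exact Nat.le_mul_of_pos_right _ hb
  | get a i => simpa [sizeWeight] using Nat.size_le.2 (hM a _)
  | op o e f he hf =>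
    refine (o.size_eval_le _ _).trans ?_
    simp only [sizeWeight, add_mul]
    omega

theorem Expr.cost_le {b : ℕ} (hb : 1 ≤ b) {M : Memory} (hM : M.Bounded b) (e : Expr) :
    e.cost M ≤ e.costWeight * b := by
  induction e with
  | lit k => exact Nat.le_mul_of_pos_right _ hb
  | get a i hi =>
    have h1 := Expr.size_eval_le hb hM i
    have h2 : (M a (i.eval M)).size ≤ b := Nat.size_le.2 (hM a _)
    simp only [cost, costWeight, add_mul]
    omega
  | op o e f he hf =>
    have h1 := Expr.size_eval_le hb hM e
    have h2 := Expr.size_eval_le hb hM f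
    simp only [cost, costWeight, add_mul]
    omega

namespace Prog

/-- The program contains a `store` to array `a`. -/
def Writes : Prog → ℕ → Prop
  | .skip, _ => False
  | .store a _ _, a' => a' = a
  | .seq P Q, a => P.Writes a ∨ Q.Writes a
  | .branch _ P Q, a => P.Writes a ∨ Q.Writes a
  | .loop _ P, a => P.Writes a

/-- A time bound, as a multiple of the bit length of the numbers in memory, for a program each of
whose loops makes at most `U` rounds. -/
def bound (U : ℕ) : Prog → ℕ
  | .skip => 1
  | .store _ i e => i.costWeight + e.costWeight + (1 + i.sizeWeight + e.sizeWeight)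
  | .seq P Q => P.bound U + Q.bound U
  | .branch e P Q => e.costWeight + 1 + (P.bound U + Q.bound U)
  | .loop e P => U * (e.costWeight + 1 + P.bound U) + (e.costWeight + 1)

/-- The nesting depth of loops. -/
def depth : Prog → ℕ
  | .skip => 0
  | .store _ _ _ => 0
  | .seq P Q => P.depth + Q.depth
  | .branch _ P Q => P.depth + Q.depth
  | .loop _ P => P.depth + 1

/-- `bound` is a polynomial in `U` of degree at most `depth`, and its value at `1` is the sum of its
coefficients. That `depth` adds up over sequences is generous, but gives both parts a common
exponent. -/
theorem bound_le (P : Prog) {U : ℕ} (hU : 1 ≤ U) : P.bound U ≤ P.bound 1 * U ^ P.depth := by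
  have key : ∀ {x y m : ℕ}, x ≤ y * U ^ m → ∀ m', m ≤ m' → x ≤ y * U ^ m' := fun h m' hm =>
    h.trans (Nat.mul_le_mul_left _ (Nat.pow_le_pow_right hU hm))
  induction P with
  | skip => simp [bound, depth]
  | store => simp [bound, depth]
  | seq P Q hP hQ =>
    have h1 := key hP (P.depth + Q.depth) (by omega)
    have h2 := key hQ (P.depth + Q.depth) (by omega)
    simp only [bound, depth, add_mul]
    omega
  | branch e P Q hP hQ =>
    have h1 := key hP (P.depth + Q.depth) (by omega)
    have h2 := key hQ (P.depth + Q.depth) (by omega)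
    have h3 : e.costWeight + 1 ≤ (e.costWeight + 1) * U ^ (P.depth + Q.depth) :=
      Nat.le_mul_of_pos_right _ (Nat.pow_pos hU)
    simp only [bound, depth, add_mul] at *
    omega
  | loop e P hP =>
    have h3 : e.costWeight + 1 ≤ (e.costWeight + 1) * U ^ P.depth :=
      Nat.le_mul_of_pos_right _ (Nat.pow_pos hU)
    have h4 : e.costWeight + 1 ≤ (e.costWeight + 1) * U ^ (P.depth + 1) :=
      Nat.le_mul_of_pos_right _ (Nat.pow_pos hU)
    have h5 : U * (e.costWeight + 1 + P.bound U) ≤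
        (e.costWeight + 1 + P.bound 1) * U ^ (P.depth + 1) := by
      calc _ ≤ U * ((e.costWeight + 1) * U ^ P.depth + P.bound 1 * U ^ P.depth) := by gcongr
        _ = _ := by ring
    simp only [bound, depth]
    rw [one_mul, add_mul _ (e.costWeight + 1)]
    omega

/-- `for x = 0, …, e - 1 do P`. -/
def forLoop (x : ℕ) (e : Expr) (P : Prog) : Prog :=
  .seq (.store x 0 0) (.loop (e - .scalar x) (.seq P (.store x 0 (.scalar x + 1))))

@[simp] theorem writes_store (a a' : ℕ) (i e : Expr) : (store a i e).Writes a' ↔ a' = a := Iff.rfl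
@[simp] theorem writes_skip (a : ℕ) : skip.Writes a ↔ False := Iff.rfl
@[simp] theorem writes_seq (P Q : Prog) (a : ℕ) :
    (seq P Q).Writes a ↔ P.Writes a ∨ Q.Writes a := Iff.rfl
@[simp] theorem writes_branch (e : Expr) (P Q : Prog) (a : ℕ) :
    (branch e P Q).Writes a ↔ P.Writes a ∨ Q.Writes a := Iff.rfl
@[simp] theorem writes_forLoop (x : ℕ) (e : Expr) (P : Prog) (a : ℕ) :
    (forLoop x e P).Writes a ↔ a = x ∨ P.Writes a := by
  simp only [forLoop, Writes]
  tauto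

end Prog

theorem Exec.frame {P : Prog} {M M' : Memory} {t : ℕ} (h : Exec P M t M') (a : ℕ)
    (ha : ¬ P.Writes a) : M' a = M a := by
  induction h with
  | skip => rfl
  | store M a' i e => exact Memory.write_of_ne _ ha
  | seq _ _ h1 h2 =>
    rw [h2 fun h => ha (Or.inr h), h1 fun h => ha (Or.inl h)]
  | branch_true _ _ h1 => exact h1 fun h => ha (Or.inl h)
  | branch_false _ _ h1 => exact h1 fun h => ha (Or.inr h)
  | loop_true _ _ _ h1 h2 => rw [h2 ha, h1 ha]
  | loop_false => rfl

/-- Started in `M`, the program `P` halts in a memory that satisfies `Q` and holds numbers of at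
most `b` bits, after time at most `P.bound U * b`. -/
def WP (b U : ℕ) (P : Prog) (Q : Memory → Prop) (M : Memory) : Prop :=
  ∃ t M', Exec P M t M' ∧ t ≤ P.bound U * b ∧ M'.Bounded b ∧ Q M'

namespace WP

variable {b U : ℕ} {P P' : Prog} {Q Q' : Memory → Prop} {M : Memory}

/-- Besides the postcondition one may use that only the arrays written to have changed. -/
theorem mono (h : WP b U P Q M)
    (hQ : ∀ M', M'.Bounded b → (∀ a, ¬ P.Writes a → M' a = M a) → Q M' → Q' M') :
    WP b U P Q' M := by
  obtain ⟨t, M', h1, h2, h3, h4⟩ := h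
  exact ⟨t, M', h1, h2, h3, hQ M' h3 (fun a ha => h1.frame a ha) h4⟩

theorem skip (hb : 1 ≤ b) (hM : M.Bounded b) (hQ : Q M) : WP b U .skip Q M :=
  ⟨1, M, .skip M, by simpa [Prog.bound] using hb, hM, hQ⟩

theorem store (hb : 1 ≤ b) (hM : M.Bounded b) {a : ℕ} {i e : Expr} (he : e.eval M < 2 ^ b)
    (hQ : (M.write a (i.eval M) (e.eval M)).Bounded b → Q (M.write a (i.eval M) (e.eval M))) :
    WP b U (.store a i e) Q M := by
  refine ⟨_, _, .store M a i e, ?_, hM.write _ _ he, hQ (hM.write _ _ he)⟩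
  have h1 := Expr.cost_le hb hM i
  have h2 := Expr.cost_le hb hM e
  have h3 := Expr.size_eval_le hb hM i
  have h4 := Expr.size_eval_le hb hM e
  simp only [Prog.bound, add_mul]
  omega

theorem seq (h : WP b U P (WP b U P' Q) M) : WP b U (.seq P P') Q M := by
  obtain ⟨t, M', h1, h2, h3, t', M'', h1', h2', h3', h4⟩ := h
  refine ⟨_, _, .seq h1 h1', ?_, h3', h4⟩
  simp only [Prog.bound, add_mul]
  omega

theorem branch (hb : 1 ≤ b) (hM : M.Bounded b) {e : Expr} (h : e.eval M ≠ 0 → WP b U P Q M)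
    (h' : e.eval M = 0 → WP b U P' Q M) : WP b U (.branch e P P') Q M := by
  have hc := Expr.cost_le hb hM e
  by_cases he : e.eval M = 0
  · obtain ⟨t, M', h1, h2, h3, h4⟩ := h' he
    refine ⟨_, _, .branch_false he h1, ?_, h3, h4⟩
    simp only [Prog.bound, add_mul]
    omega
  · obtain ⟨t, M', h1, h2, h3, h4⟩ := h he
    refine ⟨_, _, .branch_true he h1, ?_, h3, h4⟩
    simp only [Prog.bound, add_mul]
    omega

/-- The invariant for `i + 1` is required after the counter has been incremented. The hypothesis
`he` keeps the limit constant even though it is re-evaluated in each round. -/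
theorem forLoop {N x : ℕ} {e : Expr} (Inv : ℕ → Memory → Prop) (hb : 1 ≤ b) (hU : N ≤ U)
    (hN : N < 2 ^ b) (hM : M.Bounded b) (hx : ¬ P.Writes x)
    (he : ∀ M', (∀ a, a ≠ x → ¬ P.Writes a → M' a = M a) → e.eval M' = N)
    (h0 : Inv 0 (M.write x 0 0))
    (hs : ∀ i < N, ∀ M', M'.Bounded b → (∀ a, a ≠ x → ¬ P.Writes a → M' a = M a) →
      M' x 0 = i → Inv i M' → WP b U P (fun M'' => Inv (i + 1) (M''.write x 0 (i + 1))) M') :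
    WP b U (.forLoop x e P) (Inv N) M := by
  set body : Prog := .seq P (.store x 0 (.scalar x + 1)) with hbody
  -- Induction on the number `r` of rounds left; the time is that of `r` rounds and of the final
  -- failing test.
  have main : ∀ r i, i + r = N → ∀ M', M'.Bounded b →
      (∀ a, a ≠ x → ¬ P.Writes a → M' a = M a) → M' x 0 = i → Inv i M' →
      ∃ t M'', Exec (.loop (e - .scalar x) body) M' t M'' ∧
        t ≤ (r * ((e - .scalar x).costWeight + 1 + body.bound U) +
          ((e - .scalar x).costWeight + 1)) * b ∧ M''.Bounded b ∧ Inv N M'' := by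
    intro r
    induction r with
    | zero =>
      intro i hi M' hM' hf hxi hI
      obtain rfl : i = N := by simpa using hi
      refine ⟨_, _, .loop_false (by simp [he M' hf, hxi]), ?_, hM', hI⟩
      have hc := Expr.cost_le hb hM' (e - .scalar x)
      simp only [zero_mul, zero_add, add_mul]
      omega
    | succ r ih =>
      intro i hi M' hM' hf hxi hI
      obtain ⟨t, M₁, h1, h2, h3, h4⟩ :
          WP b U body (fun M'' => (Inv (i + 1) M'' ∧ M'' x 0 = i + 1)) M' := by
        refine WP.seq ((hs i (by omega) M' hM' hf hxi hI).mono ?_)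
        intro M₂ hM₂ hf₂ hI₂
        have hx₂ : M₂ x 0 = i := by rw [hf₂ x hx, hxi]
        refine WP.store hb hM₂ ?_ ?_
        · simp only [Expr.eval_add, Expr.eval_scalar, hx₂, Expr.eval_one]
          omega
        · intro _
          simp only [Expr.eval_add, Expr.eval_scalar, hx₂, Expr.eval_zero, Expr.eval_one]
          exact ⟨hI₂, by simp [Memory.write_apply]⟩
      have hf₁ : ∀ a, a ≠ x → ¬ P.Writes a → M₁ a = M a := fun a ha ha' => by
        rw [h1.frame a (by simp [hbody, ha, ha']), hf a ha ha']
      obtain ⟨t', M₂, h1', h2', h3', h4'⟩ := ih (i + 1) (by omega) M₁ h3 hf₁ h4.2 h4.1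
      refine ⟨_, _, .loop_true ?_ h1 h1', ?_, h3', h4'⟩
      · simp only [Expr.eval_sub, he M' hf, Expr.eval_scalar, hxi]
        omega
      · have hc := Expr.cost_le hb hM' (e - .scalar x)
        simp only [add_mul, one_mul] at h2' hc ⊢
        omega
  refine WP.seq (WP.store hb hM (by simp) ?_)
  intro hM'
  simp only [Expr.eval_zero] at hM' ⊢
  obtain ⟨t, M', h1, h2, h3, h4⟩ := main N 0 (by simp) _ hM'
    (fun a ha _ => Memory.write_of_ne _ ha) (by simp [Memory.write_apply]) h0
  refine ⟨t, M', h1, h2.trans ?_, h3, h4⟩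
  simp only [Prog.bound]
  gcongr
  exact le_rfl

end WP

/-! ## Dynamic programming for the knapsack problem -/

/-- The least value of `f` on the sets of items `i < m` with `ok i` whose `q`-value is at least
`v`, but at most `top`. -/
def minCost (ok : ℕ → Prop) [DecidablePred ok] (q f : ℕ → ℕ) (top : ℕ) : ℕ → ℕ → ℕ
  | 0, v => if v = 0 then 0 else top
  | m + 1, v =>
    if ok m then
      min (minCost ok q f top m v) (minCost ok q f top m (v - q m) + f m)
    else minCost ok q f top m v

section

variable {ok : ℕ → Prop} [DecidablePred ok] {q f : ℕ → ℕ} {top : ℕ}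

theorem minCost_le_top (m v : ℕ) : minCost ok q f top m v ≤ top := by
  induction m generalizing v with
  | zero => simp only [minCost]; split_ifs <;> omega
  | succ m ih =>
    simp only [minCost]
    split_ifs
    · exact (min_le_left _ _).trans (ih v)
    · exact ih v

/-- If `m` is in `S`, removing it leaves a set that meets the target `v - q m`; truncation turns a
target that is already exceeded into `0`. This is why entries refer to value at least `v` rather
than exactly `v`. -/
theorem minCost_le_sum {m v : ℕ} {S : Finset ℕ} (hS : S ⊆ (Finset.range m).filter ok)
    (hv : v ≤ ∑ i ∈ S, q i) : minCost ok q f top m v ≤ ∑ i ∈ S, f i := by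
  induction m generalizing v S with
  | zero =>
    obtain rfl : S = ∅ := by simpa using hS
    simp_all [minCost]
  | succ m ih =>
    have hS' : S.erase m ⊆ (Finset.range m).filter ok := by
      intro i hi
      have h1 := Finset.mem_erase.1 hi
      have h2 := Finset.mem_filter.1 (hS h1.2)
      simp only [Finset.mem_range, Finset.mem_filter] at h2 ⊢
      exact ⟨by omega, h2.2⟩
    by_cases hm : m ∈ S
    · have h1 : ok m := (Finset.mem_filter.1 (hS hm)).2
      rw [← Finset.sum_erase_add _ _ hm] at hv ⊢
      simp only [minCost, if_pos h1]
      have := ih hS' (v := v - q m) (by omega)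
      exact (min_le_right _ _).trans (by omega)
    · rw [Finset.erase_eq_of_notMem hm] at hS'
      have := ih hS' hv
      simp only [minCost]
      split_ifs
      · exact (min_le_left _ _).trans this
      · exact this

/-- An entry below `top` cannot stem from the default of an unreachable target, so the recursion can
be traced back to a set. -/
theorem exists_sum_eq_minCost {m v : ℕ} (h : minCost ok q f top m v < top) :
    ∃ S ⊆ (Finset.range m).filter ok, v ≤ ∑ i ∈ S, q i ∧
      ∑ i ∈ S, f i = minCost ok q f top m v := by
  induction m generalizing v with
  | zero =>
    simp only [minCost] at h ⊢
    split_ifs at h ⊢ with h0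
    · exact ⟨∅, by simp, by simp [h0], by simp⟩
    · omega
  | succ m ih =>
    have hsub : (Finset.range m).filter ok ⊆ (Finset.range (m + 1)).filter ok :=
      Finset.filter_subset_filter _ (Finset.range_subset_range.2 m.le_succ)
    simp only [minCost] at h ⊢
    split_ifs at h ⊢ with h0
    · rcases le_total (minCost ok q f top m v) (minCost ok q f top m (v - q m) + f m) with h1 | h1
      · rw [min_eq_left h1] at h ⊢
        obtain ⟨S, hS, h2⟩ := ih h
        exact ⟨S, hS.trans hsub, h2⟩
      · rw [min_eq_right h1] at h ⊢
        obtain ⟨S, hS, h2, h3⟩ := ih (v := v - q m) (by omega)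
        have hm : m ∉ S := fun hm => by simpa using hS hm
        refine ⟨insert m S, Finset.insert_subset (by simp [h0]) (hS.trans hsub), ?_, ?_⟩
        · rw [Finset.sum_insert hm]; omega
        · rw [Finset.sum_insert hm]; omega
    · obtain ⟨S, hS, h2⟩ := ih h
      exact ⟨S, hS.trans hsub, h2⟩

end

/-- The last `g v` with `v < m` that is less than `lim`. -/
def lastBelow (g : ℕ → ℕ) (lim : ℕ) : ℕ → ℕ
  | 0 => 0
  | m + 1 => if g m < lim then g m else lastBelow g lim m

theorem lastBelow_spec {g : ℕ → ℕ} {lim : ℕ} (h0 : g 0 < lim) (m : ℕ) :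
    ∃ v ≤ m, lastBelow g lim (m + 1) = g v ∧ g v < lim ∧ ∀ v' ≤ m, g v' < lim → v' ≤ v := by
  induction m with
  | zero => exact ⟨0, le_rfl, by simp [lastBelow, h0], h0, fun _ h _ => h⟩
  | succ m ih =>
    by_cases h : g (m + 1) < lim
    · exact ⟨m + 1, le_rfl, by rw [lastBelow, if_pos h], h, fun _ h _ => h⟩
    · obtain ⟨v, h1, h2, h3, h4⟩ := ih
      refine ⟨v, by omega, by rw [lastBelow, if_neg h, h2], h3, fun v' hv' hg => h4 v' ?_ hg⟩
      rcases Nat.lt_or_ge v' (m + 1) with h5 | h5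
      · omega
      · obtain rfl : v' = m + 1 := by omega
        exact absurd hg h

/-! ## Sets of items as numbers -/

theorem sum_two_pow_lt {S : Finset ℕ} {n : ℕ} (hS : S ⊆ Finset.range n) :
    ∑ i ∈ S, 2 ^ i < 2 ^ n :=
  Nat.geomSum_lt le_rfl fun _ hk => Finset.mem_range.1 (hS hk)

/-- The elements below `i` contribute less than `2 ^ i`; those above `i`, and `x * 2 ^ n` because `i
< n`, contribute multiples of `2 ^ (i + 1)`. -/
theorem add_sum_two_pow_div_mod {S : Finset ℕ} {n : ℕ} {i : ℕ}
    (hi : i < n) (x : ℕ) : (x * 2 ^ n + ∑ l ∈ S, 2 ^ l) / 2 ^ i % 2 = if i ∈ S then 1 else 0 := by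
  classical
  obtain ⟨y, hy⟩ : 2 ^ (i + 1) ∣ x * 2 ^ n :=
    Dvd.dvd.mul_left (pow_dvd_pow 2 (by omega)) x
  obtain ⟨z, hz⟩ : 2 ^ (i + 1) ∣ ∑ l ∈ S.filter (i < ·), 2 ^ l :=
    Finset.dvd_sum fun l hl => pow_dvd_pow 2 (by simp at hl; omega)
  have h1 : ∑ l ∈ S.filter (· < i), 2 ^ l < 2 ^ i :=
    Nat.geomSum_lt le_rfl fun _ hk => (Finset.mem_filter.1 hk).2
  have h2 : ∑ l ∈ S, 2 ^ l = ∑ l ∈ S.filter (· < i), 2 ^ l +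
      ((if i ∈ S then 2 ^ i else 0) + ∑ l ∈ S.filter (i < ·), 2 ^ l) := by
    rw [← Finset.sum_filter_add_sum_filter_not S (· < i)]
    congr 1
    rw [← Finset.sum_filter_add_sum_filter_not (S.filter (¬ · < i)) (· = i), Finset.filter_filter,
      Finset.filter_filter]
    congr 1
    · rw [← Finset.sum_ite_eq' S i (fun l => 2 ^ l), ← Finset.sum_filter]
      congr 1
      ext l
      simp only [Finset.mem_filter]
      exact ⟨fun h => ⟨h.1, h.2.2⟩, fun h => ⟨h.1, by omega, h.2⟩⟩
    · congr 1
      ext l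
      simp only [Finset.mem_filter]
      exact ⟨fun h => ⟨h.1, by omega⟩, fun h => ⟨h.1, by omega, by omega⟩⟩
  rw [hy, h2, hz]
  have h3 : 2 ^ (i + 1) * y + (∑ l ∈ S.filter (· < i), 2 ^ l +
      ((if i ∈ S then 2 ^ i else 0) + 2 ^ (i + 1) * z)) =
      ∑ l ∈ S.filter (· < i), 2 ^ l + 2 ^ i * ((if i ∈ S then 1 else 0) + 2 * (y + z)) := by
    split_ifs <;> ring
  rw [h3, Nat.add_mul_div_left _ _ (by positivity), Nat.div_eq_of_lt h1]
  split_ifs <;> omega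

/-! ## The knapsack problems with a leading item -/

/-- The data of an instance as functions on `ℕ`, together with an accuracy parameter. -/
structure Data where
  n : ℕ
  c : ℕ
  K : ℕ
  p : ℕ → ℕ
  w : ℕ → ℕ
  pen : ℕ → ℕ

namespace Data

variable (D : Data)

/-- A number that exceeds all total profits. -/
def R : ℕ := 1 + ∑ i ∈ Finset.range D.n, D.p i

/-- The scaling factor: profits are counted in units of `maxProfit / NK`, so that rounding up to `n`
items loses at most `maxProfit / K` in total. -/
def NK : ℕ := D.n * D.K

/-- The greatest possible scaled profit. -/
def V : ℕ := D.n * D.NK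

/-- One unit of weight in a code; it exceeds everything that the profit and element digits of a set
can contribute. -/
def base : ℕ := 2 ^ D.n * D.R

/-- The sum of these numbers over a set encodes its weight, its profit and its elements. -/
def code (i : ℕ) : ℕ := D.w i * D.base + D.p i * 2 ^ D.n + 2 ^ i

/-- Item `i` comes after item `j`, and both together fit into the knapsack. -/
def Eligible (j i : ℕ) : Prop :=
  D.pen i < D.pen j + (if j < i then 1 else 0) ∧ D.w i + D.w j ≤ D.c

instance (j : ℕ) : DecidablePred (D.Eligible j) := fun _ => inferInstanceAs (Decidable (_ ∧ _))

/-- The greatest profit of an eligible item `i < m`. -/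
def maxProfit (j : ℕ) : ℕ → ℕ
  | 0 => 0
  | m + 1 => if D.Eligible j m then max (maxProfit j m) (D.p m) else maxProfit j m

/-- The scaled profit of item `i`. -/
def scaled (j i : ℕ) : ℕ := D.p i * D.NK / D.maxProfit j D.n

/-- The entry for unreachable targets: the codes of sets of weight at most `c` lie below it. -/
def top : ℕ := (D.c + 1) * D.base

/-- The table of the dynamic program with leading item `j` after processing the items `i < m`. -/
def table (j m v : ℕ) : ℕ := minCost (D.Eligible j) (D.scaled j) D.code D.top m v

/-- The code of the solution for the items after `j`. -/
def solution (j : ℕ) : ℕ :=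
  lastBelow (D.table j D.n) ((D.c + 1 - D.w j) * D.base) (D.V + 1)

theorem le_maxProfit {j i m : ℕ} (him : i < m) (hi : D.Eligible j i) :
    D.p i ≤ D.maxProfit j m := by
  induction m with
  | zero => omega
  | succ m ih =>
    rcases Nat.lt_succ_iff_lt_or_eq.1 him with h | rfl
    · have := ih h
      simp only [maxProfit]
      split_ifs <;> omega
    · simp [maxProfit, hi]

theorem maxProfit_mem (j m : ℕ) :
    D.maxProfit j m = 0 ∨ ∃ i < m, D.Eligible j i ∧ D.maxProfit j m = D.p i := by
  induction m with
  | zero => exact Or.inl rfl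
  | succ m ih =>
    have h0 : D.maxProfit j m = 0 ∨ ∃ i < m + 1, D.Eligible j i ∧ D.maxProfit j m = D.p i :=
      ih.imp_right fun ⟨i, h1, h2⟩ => ⟨i, by omega, h2⟩
    simp only [maxProfit]
    split_ifs with h
    · rcases le_total (D.maxProfit j m) (D.p m) with h1 | h1
      · rw [max_eq_right h1]
        exact Or.inr ⟨m, by omega, h, rfl⟩
      · rwa [max_eq_left h1]
    · exact h0

theorem R_pos : 0 < D.R := by simp [R]

theorem base_pos : 0 < D.base := Nat.mul_pos (by positivity) D.R_pos

variable {D}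

theorem sum_code (S : Finset ℕ) : ∑ i ∈ S, D.code i =
    ((∑ i ∈ S, D.w i) * D.R + ∑ i ∈ S, D.p i) * 2 ^ D.n + ∑ i ∈ S, 2 ^ i := by
  simp only [code, base, Finset.sum_add_distrib, ← Finset.sum_mul]
  ring

theorem sum_p_lt {S : Finset ℕ} (hS : S ⊆ Finset.range D.n) : ∑ i ∈ S, D.p i < D.R := by
  have := Finset.sum_le_sum_of_subset (f := D.p) hS
  unfold R
  omega

/-- Powers of two sum to less than `2 ^ n` and profits to less than `R`, so no carry reaches the
weight digit: dividing a code by `base` gives exactly the weight. -/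
theorem sum_code_lt_iff {S : Finset ℕ} (hS : S ⊆ Finset.range D.n) (x : ℕ) :
    ∑ i ∈ S, D.code i < (x + 1) * D.base ↔ ∑ i ∈ S, D.w i ≤ x := by
  have h1 := sum_p_lt hS
  have h2 := sum_two_pow_lt hS
  have h4 : (∑ i ∈ S, D.code i) / D.base = ∑ i ∈ S, D.w i := by
    rw [sum_code, base, ← Nat.div_div_eq_div_mul, Nat.add_comm,
      Nat.add_mul_div_right _ _ (by positivity), Nat.div_eq_of_lt h2, zero_add, Nat.add_comm,
      Nat.add_mul_div_right _ _ D.R_pos, Nat.div_eq_of_lt h1, zero_add]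
  rw [← Nat.div_lt_iff_lt_mul D.base_pos, h4, Nat.lt_succ_iff]

theorem sum_code_profit {S : Finset ℕ} (hS : S ⊆ Finset.range D.n) :
    (∑ i ∈ S, D.code i) / 2 ^ D.n % D.R = ∑ i ∈ S, D.p i := by
  rw [sum_code, Nat.add_comm, Nat.add_mul_div_right _ _ (by positivity),
    Nat.div_eq_of_lt (sum_two_pow_lt hS), zero_add, Nat.mul_comm,
    Nat.mul_add_mod, Nat.mod_eq_of_lt (sum_p_lt hS)]

theorem sum_code_mem {S : Finset ℕ} {i : ℕ} (hi : i < D.n) :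
    (∑ l ∈ S, D.code l) / 2 ^ i % 2 = if i ∈ S then 1 else 0 := by
  rw [sum_code, add_sum_two_pow_div_mod hi]

theorem code_lt {i : ℕ} (hi : i < D.n) : D.code i < (D.w i + 1) * D.base := by
  simpa using (sum_code_lt_iff (D := D) (S := {i}) (by simpa using hi) (D.w i)).2 (by simp)

theorem scaled_le (j i : ℕ) (hi : D.Eligible j i) (hin : i < D.n) : D.scaled j i ≤ D.NK := by
  unfold scaled
  refine Nat.div_le_of_le_mul ?_
  gcongr
  exact D.le_maxProfit hin hi

/-- The dynamic program yields a `(1 - 1 / K)`-approximate solution of the knapsack problem for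
the eligible items. -/
theorem exists_solution {j : ℕ} (hj : D.w j ≤ D.c) :
    ∃ T ⊆ (Finset.range D.n).filter (D.Eligible j), ∑ i ∈ T, D.code i = D.solution j ∧
      ∑ i ∈ T, D.w i ≤ D.c - D.w j ∧
      ∀ S ⊆ (Finset.range D.n).filter (D.Eligible j), ∑ i ∈ S, D.w i ≤ D.c - D.w j →
        ∃ S' ⊆ (Finset.range D.n).filter (D.Eligible j), ∑ i ∈ S', D.w i ≤ D.c - D.w j ∧
          D.K * ∑ i ∈ S, D.p i ≤ D.K * ∑ i ∈ T, D.p i + ∑ i ∈ S', D.p i := by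
  have hc : D.c + 1 - D.w j = D.c - D.w j + 1 := by omega
  have hrange : ∀ S ⊆ (Finset.range D.n).filter (D.Eligible j), S ⊆ Finset.range D.n :=
    fun S hS => hS.trans (Finset.filter_subset _ _)
  have h0 : D.table j D.n 0 < (D.c + 1 - D.w j) * D.base := by
    have : D.table j D.n 0 ≤ 0 := by
      simpa only [table, Finset.sum_empty] using
        minCost_le_sum (f := D.code) (top := D.top) (Finset.empty_subset _) (Nat.zero_le _)
    exact this.trans_lt (Nat.mul_pos (by omega) D.base_pos)
  obtain ⟨v, hv, hsol, hlt, hmax⟩ := lastBelow_spec h0 D.V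
  have hle : (D.c + 1 - D.w j) * D.base ≤ D.top := Nat.mul_le_mul_right _ (by omega)
  obtain ⟨T, hT, hvT, hcode⟩ := exists_sum_eq_minCost (hlt.trans_le hle)
  refine ⟨T, hT, hcode.trans hsol.symm, ?_, ?_⟩
  · rw [← sum_code_lt_iff (hrange T hT), hcode, ← hc]
    exact hlt
  intro S hS hSw
  -- The scaled profit of `S` is an index at most `V` whose entry is below the limit, since `S`
  -- itself witnesses it; `v` is the greatest such index.
  have hq : ∑ i ∈ S, D.scaled j i ≤ ∑ i ∈ T, D.scaled j i := by
    refine le_trans (hmax _ ?_ ?_) hvT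
    · calc _ ≤ ∑ i ∈ S, D.NK := Finset.sum_le_sum fun i hi => by
            have := hS hi
            simp only [Finset.mem_filter, Finset.mem_range] at this
            exact scaled_le j i this.2 this.1
        _ ≤ D.V := by
          rw [Finset.sum_const, smul_eq_mul, V]
          gcongr
          simpa using Finset.card_le_card (hrange S hS)
    · refine (minCost_le_sum hS le_rfl).trans_lt ?_
      rw [hc]
      exact (sum_code_lt_iff (hrange S hS) _).2 hSw
  set m := D.maxProfit j D.n with hm
  -- Rounding down loses at most one unit per item. If `m = 0`, the division by zero is harmless
  -- because all eligible profits vanish.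
  have h1 : ∀ i ∈ S, D.p i * D.NK ≤ m * D.scaled j i + m := by
    intro i hi
    have := hS hi
    simp only [Finset.mem_filter, Finset.mem_range] at this
    have h := D.le_maxProfit this.1 this.2
    rcases Nat.eq_zero_or_pos m with h' | h'
    · rw [← hm, h'] at h
      simp [Nat.le_zero.1 h]
    · have := (Nat.lt_mul_div_succ (D.p i * D.NK) h').le
      rw [mul_add, mul_one] at this
      exact this
  have h2 : (∑ i ∈ S, D.p i) * D.NK ≤ (∑ i ∈ T, D.p i) * D.NK + D.n * m := by
    calc (∑ i ∈ S, D.p i) * D.NK ≤ ∑ i ∈ S, (m * D.scaled j i + m) := by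
          rw [Finset.sum_mul]; exact Finset.sum_le_sum h1
      _ = m * ∑ i ∈ S, D.scaled j i + S.card * m := by
          rw [Finset.sum_add_distrib, Finset.mul_sum, Finset.sum_const, smul_eq_mul]
      _ ≤ m * ∑ i ∈ T, D.scaled j i + D.n * m := by
          gcongr
          simpa using Finset.card_le_card (hrange S hS)
      _ ≤ _ := by
          refine Nat.add_le_add_right ?_ _
          rw [Finset.mul_sum, Finset.sum_mul]
          exact Finset.sum_le_sum fun i _ => Nat.mul_div_le _ _
  have h3 : D.K * ∑ i ∈ S, D.p i ≤ D.K * ∑ i ∈ T, D.p i + m := by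
    rcases Nat.eq_zero_or_pos D.n with hn | hn
    · have : S = ∅ := by
        have := hrange S hS
        rw [hn] at this
        simpa using this
      simp [this]
    · refine Nat.le_of_mul_le_mul_left ?_ hn
      unfold NK at h2
      calc _ = (∑ i ∈ S, D.p i) * (D.n * D.K) := by ring
        _ ≤ _ := h2
        _ = _ := by ring
  -- The witness `S'` is a single item of greatest profit `m`, which fits by eligibility; if `m =
  -- 0`, the empty set does.
  rcases D.maxProfit_mem j D.n with h | ⟨i, hi, hi', h⟩
  · exact ⟨∅, by simp, by simp, by simpa [← hm ▸ h] using h3⟩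
  · refine ⟨{i}, by simp [hi, hi'], ?_, by rwa [Finset.sum_singleton, ← h]⟩
    have := hi'.2
    rw [Finset.sum_singleton]
    omega

end Data
/-! ## The program -/

namespace Code

/-- The number of items. -/
def n : Expr := .get 0 0
def c : Expr := .get 0 1
def p (i : Expr) : Expr := .get 1 i
def w (i : Expr) : Expr := .get 2 i
def pen (i : Expr) : Expr := .get 3 i
/-- The powers of two. -/
def pow (i : Expr) : Expr := .get 5 i
def R : Expr := .scalar 6
def NK : Expr := .scalar 7
def V : Expr := .scalar 8
def base : Expr := .scalar 9
/-- The leading item. -/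
def j : Expr := .scalar 10
/-- The greatest profit of an eligible item. -/
def maxP : Expr := .scalar 11
/-- The running item. -/
def i : Expr := .scalar 12
/-- The table of the dynamic program. -/
def f (v : Expr) : Expr := .get 13 v
/-- The running index in the table. -/
def x : Expr := .scalar 14
def q : Expr := .scalar 15
def codeI : Expr := .scalar 16
/-- The selected table entry. -/
def sel : Expr := .scalar 17
def bestValue : Expr := .scalar 18
def bestCode : Expr := .scalar 19

def eligible : Expr := (pen j + (1 - (1 - (i - j))) - pen i) * (c + 1 - w j - w i)

def code (e : Expr) : Expr := w e * base + p e * pow n + pow e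

/-- The profit digit of the selected code minus the penalty; truncation replaces a negative value by
that of the empty set. -/
def gain : Expr := .rem (sel / pow n) R - pen j

/-- The tables of constants; `d` is the factor by which the accuracy parameter is multiplied. -/
def init (d : ℕ) : Prog :=
  .seq (.store 5 0 1) <| .seq (.store 6 0 1) <|
  .seq (.forLoop 12 n (.seq (.store 5 (i + 1) (2 * pow i)) (.store 6 0 (R + p i)))) <|
  .seq (.store 7 0 (n * (.get 0 2 * .lit d))) <|
  .seq (.store 8 0 (n * NK)) <| .store 9 0 (pow n * R)

def maxProfit : Prog :=
  .seq (.store 11 0 0) <| .forLoop 12 n <|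
  .branch eligible (.store 11 0 (maxP + (p i - maxP))) .skip

def initTable : Prog :=
  .seq (.forLoop 14 (V + 1) (.store 13 x ((c + 1) * base))) (.store 13 0 0)

/-- Running downwards through the indices lets one array hold both rows: the entry at `V - x - q`
has not been overwritten yet when it is read. The expression `a - (a - b)` is the minimum of `a` and
`b`. -/
def updateTable : Prog :=
  .forLoop 14 (V + 1) (.store 13 (V - x) (f (V - x) - (f (V - x) - (f (V - x - q) + codeI))))

def fillTable : Prog :=
  .forLoop 12 n <| .branch eligible
    (.seq (.store 15 0 (p i * NK / maxP)) <| .seq (.store 16 0 (code i)) updateTable) .skip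

def select : Prog :=
  .seq (.store 17 0 0) <| .forLoop 14 (V + 1) <|
  .branch ((c + 1 - w j) * base - f x) (.store 17 0 (f x)) .skip

def compare : Prog :=
  .seq (.store 17 0 (sel + code j)) <| .branch (gain - bestValue)
    (.seq (.store 18 0 gain) (.store 19 0 sel)) .skip

def search : Prog :=
  .forLoop 10 n <| .branch (c + 1 - w j)
    (.seq maxProfit <| .seq initTable <| .seq fillTable <| .seq select compare) .skip

def output : Prog := .forLoop 12 n (.store 4 i (.rem (bestCode / pow i) 2))

def main (d : ℕ) : Prog := .seq (init d) (.seq search output)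

end Code

/-! ### Correctness of the program -/

namespace Data

variable (D : Data)

/-- The value of the candidate with leading item `j`, or `0` if this is negative. -/
def gain (j : ℕ) : ℕ := (D.solution j + D.code j) / 2 ^ D.n % D.R - D.pen j

/-- Value and code of a best candidate among the empty set and those with leading item `j < m`. -/
def best : ℕ → ℕ × ℕ
  | 0 => (0, 0)
  | m + 1 =>
    if D.w m ≤ D.c ∧ (best m).1 < D.gain m then (D.gain m, D.solution m + D.code m) else best m

/-- The memory holds the instance and the constants computed from it. -/
structure Env (M : Memory) : Prop where
  n : M 0 0 = D.n
  c : M 0 1 = D.c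
  p : ∀ i < D.n, M 1 i = D.p i
  w : ∀ i < D.n, M 2 i = D.w i
  pen : ∀ i < D.n, M 3 i = D.pen i
  pow : ∀ i ≤ D.n, M 5 i = 2 ^ i
  R : M 6 0 = D.R
  NK : M 7 0 = D.NK
  V : M 8 0 = D.V
  base : M 9 0 = D.base

/-- The numbers that occur have at most `b` bits and bound the number of rounds by `U`. -/
structure Fits (b U : ℕ) : Prop where
  one_le : 1 ≤ b
  n_le : D.n ≤ U
  V_lt : D.V < U
  U_lt : U < 2 ^ b
  NK_lt : D.NK < 2 ^ b
  top_lt : 2 * D.top < 2 ^ b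

variable {D} {b U : ℕ} {M M' : Memory}

theorem Env.congr (h : D.Env M) (hM : ∀ a < 10, a ≠ 4 → M' a = M a) : D.Env M' where
  n := by rw [hM 0 (by omega) (by omega), h.n]
  c := by rw [hM 0 (by omega) (by omega), h.c]
  p := by rw [hM 1 (by omega) (by omega)]; exact h.p
  w := by rw [hM 2 (by omega) (by omega)]; exact h.w
  pen := by rw [hM 3 (by omega) (by omega)]; exact h.pen
  pow := by rw [hM 5 (by omega) (by omega)]; exact h.pow
  R := by rw [hM 6 (by omega) (by omega), h.R]
  NK := by rw [hM 7 (by omega) (by omega), h.NK]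
  V := by rw [hM 8 (by omega) (by omega), h.V]
  base := by rw [hM 9 (by omega) (by omega), h.base]

/-- A product of truncated differences is nonzero exactly if both strict inequalities hold; `1 - (1
- (i - j))` is the indicator of `j < i`, which breaks ties between equal penalties. -/
theorem Env.eval_eligible (h : D.Env M) {j i : ℕ} (hj : M 10 0 = j) (hi : M 12 0 = i)
    (hjn : j < D.n) (hin : i < D.n) : Code.eligible.eval M ≠ 0 ↔ D.Eligible j i := by
  simp only [Code.eligible, Code.pen, Code.j, Code.i, Code.c, Code.w, Expr.eval_mul, Expr.eval_sub,
    Expr.eval_add, Expr.eval_get, Expr.eval_scalar, Expr.eval_one, hj, hi,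
    h.c, h.w i hin, h.w j hjn, h.pen i hin, h.pen j hjn, Eligible, mul_ne_zero_iff]
  refine and_congr ?_ ?_
  · split_ifs <;> omega
  · omega

theorem table_le_top (j m v : ℕ) : D.table j m v ≤ D.top := minCost_le_top m v

theorem code_lt_top {i : ℕ} (hi : i < D.n) (hw : D.w i ≤ D.c) : D.code i < D.top :=
  (code_lt hi).trans_le (Nat.mul_le_mul_right _ (by omega))

theorem lastBelow_le {g : ℕ → ℕ} {t : ℕ} (h : ∀ v, g v ≤ t) (lim m : ℕ) :
    lastBelow g lim m ≤ t := by
  induction m with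
  | zero => simp [lastBelow]
  | succ m ih =>
    simp only [lastBelow]
    split_ifs
    · exact h m
    · exact ih

theorem solution_le_top (j : ℕ) : D.solution j ≤ D.top :=
  lastBelow_le (D.table_le_top j D.n) _ _

section Triples

open Code

theorem wp_maxProfit (hF : D.Fits b U) (hM : M.Bounded b) (h : D.Env M) {j : ℕ} (hj : M 10 0 = j)
    (hjn : j < D.n) : WP b U Code.maxProfit (fun M' => M' 11 0 = D.maxProfit j D.n) M := by
  refine WP.seq (WP.store hF.one_le hM (by simp) fun hM₁ => ?_)
  have hb := hF.one_le
  refine WP.forLoop (N := D.n) (fun m M' => M' 11 0 = D.maxProfit j m) hb hF.n_le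
    (hF.n_le.trans_lt hF.U_lt) hM₁ (by simp) ?_ ?_ ?_
  · intro M' hf
    simp only [Code.n, Expr.eval_get, Expr.eval_zero]
    rw [hf 0 (by omega) (by simp), Memory.write_of_ne _ (by omega), h.n]
  · simp [Memory.write_apply, maxProfit]
  · intro m hm M' hM' hf hi hI
    have h' : D.Env M' := h.congr fun a ha _ => by
      rw [hf a (by omega) (by simp; omega), Memory.write_of_ne _ (by omega)]
    have hj' : M' 10 0 = j := by
      rw [hf 10 (by omega) (by simp), Memory.write_of_ne _ (by omega), hj]
    have hel := h'.eval_eligible hj' hi hjn hm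
    refine WP.branch hb hM' (fun he => ?_) (fun he => ?_)
    · have hev : (maxP + (Code.p i - maxP)).eval M' = D.maxProfit j (m + 1) := by
        simp only [maxP, Code.p, i, Expr.eval_add, Expr.eval_sub, Expr.eval_get, Expr.eval_scalar,
          hI, hi, h'.p m hm, maxProfit, if_pos (hel.1 he)]
        omega
      refine WP.store hb hM' ?_ fun _ => ?_
      · rw [hev, maxProfit, if_pos (hel.1 he), ← hI, ← h'.p m hm]
        exact max_lt (hM' _ _) (hM' _ _)
      · rw [hev]
        simp [Memory.write_apply]
    · refine WP.skip hb hM' ?_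
      have : ¬ D.Eligible j m := fun hn => hel.2 hn he
      simp [Memory.write_apply, maxProfit, this, hI]

theorem wp_initTable (hF : D.Fits b U) (hM : M.Bounded b) (h : D.Env M) (j : ℕ) :
    WP b U initTable (fun M' => ∀ v ≤ D.V, M' 13 v = D.table j 0 v) M := by
  have hb := hF.one_le
  have htop := hF.top_lt
  refine WP.seq ((WP.forLoop (N := D.V + 1) (fun m M' => ∀ v < m, M' 13 v = D.top)
    hb hF.V_lt (Nat.lt_of_le_of_lt hF.V_lt hF.U_lt) hM (by simp) ?_ (by simp) ?_).mono ?_)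
  · intro M' hf
    simp only [Code.V, Expr.eval_add, Expr.eval_scalar, Expr.eval_one]
    rw [hf 8 (by omega) (by simp), h.V]
  · intro m hm M' hM' hf hi hI
    have h' : D.Env M' := h.congr fun a ha _ => hf a (by omega) (by simp; omega)
    have hev : ((Code.c + 1) * Code.base).eval M' = D.top := by
      simp [Code.c, Code.base, h'.c, h'.base, top]
    refine WP.store hb hM' ?_ fun _ => ?_
    · rw [hev]; omega
    · rw [hev]
      intro v hv
      have hx : x.eval M' = m := hi
      simp only [Memory.write_apply, hx]
      simp only [show ¬ ((13 : ℕ) = 14) by omega, false_and, if_false, true_and]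
      split_ifs with hvm
      · rfl
      · exact hI v (by omega)
  · intro M' hM' _ hI
    refine WP.store hb hM' (by simp) fun _ v hv => ?_
    simp only [Memory.write_apply, Expr.eval_zero, true_and, table, minCost]
    split_ifs with hv0
    · rfl
    · exact hI v (by omega)

theorem wp_updateTable (hF : D.Fits b U) (hM : M.Bounded b) (h : D.Env M) {j m : ℕ}
    (hq : M 15 0 = D.scaled j m) (hc : M 16 0 = D.code m) (hm : D.Eligible j m)
    (hI : ∀ v ≤ D.V, M 13 v = D.table j m v) :
    WP b U updateTable (fun M' => ∀ v ≤ D.V, M' 13 v = D.table j (m + 1) v) M := by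
  have hb := hF.one_le
  have htop := hF.top_lt
  -- After `y` rounds the `y` greatest indices hold the new row and the others still the old one.
  refine (WP.forLoop (N := D.V + 1) (fun y M' => ∀ v ≤ D.V, M' 13 v =
    if D.V < v + y then D.table j (m + 1) v else D.table j m v)
    hb hF.V_lt (Nat.lt_of_le_of_lt hF.V_lt hF.U_lt) hM (by simp) ?_ ?_ ?_).mono ?_
  · intro M' hf
    simp only [Code.V, Expr.eval_add, Expr.eval_scalar, Expr.eval_one]
    rw [hf 8 (by omega) (by simp), h.V]
  · intro v hv
    rw [Memory.write_of_ne _ (by omega), if_neg (by omega), hI v hv]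
  · intro y hy M' hM' hf hx hI'
    have h' : D.Env M' := h.congr fun a ha _ => hf a (by omega) (by simp; omega)
    have hx' : (Code.V - x).eval M' = D.V - y := by
      simp [Code.V, x, h'.V, hx]
    have hev : (f (Code.V - x) - (f (Code.V - x) - (f (Code.V - x - q) + codeI))).eval M' =
        D.table j (m + 1) (D.V - y) := by
      have hq' : q.eval M' = D.scaled j m := by
        rw [q, Expr.eval_scalar, hf 15 (by omega) (by simp), hq]
      have hc' : codeI.eval M' = D.code m := by
        rw [codeI, Expr.eval_scalar, hf 16 (by omega) (by simp), hc]
      simp only [f, Expr.eval_sub, Expr.eval_add, Expr.eval_get, hq', hc']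
      simp only [← Expr.eval_sub, hx']
      rw [hI' _ (by omega), hI' _ (by omega), if_neg (by omega), if_neg (by omega)]
      have : D.table j (m + 1) (D.V - y) = min (D.table j m (D.V - y))
          (D.table j m (D.V - y - D.scaled j m) + D.code m) := by
        simp only [table, minCost, if_pos hm]
      omega
    refine WP.store hb hM' ?_ fun _ => ?_
    · rw [hev]
      have := D.table_le_top j (m + 1) (D.V - y)
      omega
    · rw [hev, hx']
      intro v hv
      simp only [Memory.write_apply]
      simp only [show ¬ ((13 : ℕ) = 14) by omega, false_and, if_false, true_and]
      by_cases hvy : v = D.V - y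
      · rw [if_pos hvy, if_pos (by omega), hvy]
      · rw [if_neg hvy, hI' v hv]
        congr 1
        exact propext (by omega)
  · intro M' _ _ hI' v hv
    rw [hI' v hv, if_pos (by omega)]

theorem eval_code (h : D.Env M) {e : Expr} {m : ℕ} (he : e.eval M = m) (hm : m < D.n) :
    (Code.code e).eval M = D.code m := by
  simp [Code.code, Code.w, Code.p, Code.pow, Code.base, Code.n, he, h.n, h.w m hm, h.p m hm,
    h.base, h.pow m hm.le, h.pow D.n le_rfl, Data.code]

theorem wp_fillTable (hF : D.Fits b U) (hM : M.Bounded b) (h : D.Env M) {j : ℕ}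
    (hj : M 10 0 = j) (hjn : j < D.n) (hp : M 11 0 = D.maxProfit j D.n)
    (hI : ∀ v ≤ D.V, M 13 v = D.table j 0 v) :
    WP b U fillTable (fun M' => ∀ v ≤ D.V, M' 13 v = D.table j D.n v) M := by
  have hb := hF.one_le
  have htop := hF.top_lt
  refine WP.forLoop (N := D.n) (fun m M' => ∀ v ≤ D.V, M' 13 v = D.table j m v)
    hb hF.n_le (hF.n_le.trans_lt hF.U_lt) hM (by simp [updateTable]) ?_ ?_ ?_
  · intro M' hf
    simp only [Code.n, Expr.eval_get, Expr.eval_zero]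
    rw [hf 0 (by omega) (by simp [updateTable]), h.n]
  · simpa [Memory.write_apply] using hI
  · intro m hm M' hM' hf hi hI'
    have h' : D.Env M' := h.congr fun a ha _ => hf a (by omega) (by simp [updateTable]; omega)
    have hj' : M' 10 0 = j := by rw [hf 10 (by omega) (by simp [updateTable]), hj]
    have hp' : M' 11 0 = D.maxProfit j D.n := by
      rw [hf 11 (by omega) (by simp [updateTable]), hp]
    have hel := h'.eval_eligible hj' hi hjn hm
    refine WP.branch hb hM' (fun he => ?_) (fun he => ?_)
    · have hel' := hel.1 he
      have hq : (Code.p i * Code.NK / maxP).eval M' = D.scaled j m := by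
        simp [Code.p, i, Code.NK, maxP, hi, h'.p m hm, h'.NK, hp', scaled]
      refine WP.seq (WP.store hb hM' ?_ fun hM₁ => ?_)
      · rw [hq]
        exact (scaled_le j m hel' hm).trans_lt hF.NK_lt
      rw [hq, Expr.eval_zero] at hM₁ ⊢
      set M₁ := M'.write 15 0 (D.scaled j m) with hM₁def
      have h₁ : D.Env M₁ := h'.congr fun a ha _ => Memory.write_of_ne _ (by omega)
      have hc : (Code.code i).eval M₁ = D.code m :=
        eval_code h₁ (by simp [i, hM₁def, Memory.write_apply, hi]) hm
      refine WP.seq (WP.store hb hM₁ ?_ fun hM₂ => ?_)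
      · rw [hc]
        have := code_lt_top (D := D) hm (by have := hel'.2; omega)
        omega
      rw [hc, Expr.eval_zero] at hM₂ ⊢
      set M₂ := M₁.write 16 0 (D.code m) with hM₂def
      have h₂ : D.Env M₂ := h₁.congr fun a ha _ => Memory.write_of_ne _ (by omega)
      refine (wp_updateTable hF hM₂ h₂ ?_ ?_ hel' ?_).mono ?_
      · simp [hM₂def, hM₁def, Memory.write_apply]
      · simp [hM₂def, Memory.write_apply]
      · intro v hv
        simp [hM₂def, hM₁def, Memory.write_apply, hI' v hv]
      · intro M₃ _ _ hI₃ v hv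
        simp [Memory.write_apply, hI₃ v hv]
    · refine WP.skip hb hM' fun v hv => ?_
      have : ¬ D.Eligible j m := fun hn => hel.2 hn he
      simp [Memory.write_apply, hI' v hv, table, minCost, this]

theorem wp_select (hF : D.Fits b U) (hM : M.Bounded b) (h : D.Env M) {j : ℕ}
    (hj : M 10 0 = j) (hjn : j < D.n) (hI : ∀ v ≤ D.V, M 13 v = D.table j D.n v) :
    WP b U select (fun M' => M' 17 0 = D.solution j) M := by
  have hb := hF.one_le
  have htop := hF.top_lt
  refine WP.seq (WP.store hb hM (by simp) fun hM₁ => ?_)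
  refine WP.forLoop (N := D.V + 1) (fun m M' => M' 17 0 = lastBelow (D.table j D.n)
    ((D.c + 1 - D.w j) * D.base) m) hb hF.V_lt (Nat.lt_of_le_of_lt hF.V_lt hF.U_lt) hM₁ (by simp)
    ?_ (by simp [Memory.write_apply, lastBelow]) ?_
  · intro M' hf
    simp only [Code.V, Expr.eval_add, Expr.eval_scalar, Expr.eval_one]
    rw [hf 8 (by omega) (by simp), Memory.write_of_ne _ (by omega), h.V]
  · intro m hm M' hM' hf hx hI'
    have hf' : ∀ a, a ≠ 14 → a ≠ 17 → M' a = M a := fun a ha ha' => by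
      rw [hf a ha (by simp [ha']), Memory.write_of_ne _ ha']
    have h' : D.Env M' := h.congr fun a ha _ => hf' a (by omega) (by omega)
    have hj' : M' 10 0 = j := by rw [hf' 10 (by omega) (by omega), hj]
    have hfx : (f x).eval M' = D.table j D.n m := by
      rw [f, Expr.eval_get, x, Expr.eval_scalar, hx, hf' 13 (by omega) (by omega),
        hI m (by omega)]
    have hcond : ((Code.c + 1 - Code.w Code.j) * Code.base - f x).eval M' =
        (D.c + 1 - D.w j) * D.base - D.table j D.n m := by
      rw [Expr.eval_sub, hfx]
      simp [Code.c, Code.w, Code.j, Code.base, h'.c, h'.base, hj', h'.w j hjn]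
    refine WP.branch hb hM' (fun he => ?_) (fun he => ?_)
    · rw [hcond] at he
      refine WP.store hb hM' ?_ fun _ => ?_
      · rw [hfx]
        have := D.table_le_top j D.n m
        omega
      · rw [hfx]
        have : D.table j D.n m < (D.c + 1 - D.w j) * D.base := by omega
        simp [Memory.write_apply, lastBelow, this]
    · rw [hcond] at he
      refine WP.skip hb hM' ?_
      have : ¬ D.table j D.n m < (D.c + 1 - D.w j) * D.base := by omega
      simp [Memory.write_apply, lastBelow, this, hI']

theorem R_le_top : D.R ≤ D.top :=
  (Nat.le_mul_of_pos_left _ (by positivity)).trans (Nat.le_mul_of_pos_left _ (by omega))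

theorem wp_compare (hF : D.Fits b U) (hM : M.Bounded b) (h : D.Env M) {j : ℕ}
    (hj : M 10 0 = j) (hjn : j < D.n) (hw : D.w j ≤ D.c) (hs : M 17 0 = D.solution j)
    (h1 : M 18 0 = (D.best j).1) (h2 : M 19 0 = (D.best j).2) :
    WP b U Code.compare
      (fun M' => M' 18 0 = (D.best (j + 1)).1 ∧ M' 19 0 = (D.best (j + 1)).2) M := by
  have hb := hF.one_le
  have htop := hF.top_lt
  have hsel : (sel + Code.code Code.j).eval M = D.solution j + D.code j := by
    rw [Expr.eval_add, eval_code h (m := j) (by simpa [Code.j] using hj) hjn, sel, Expr.eval_scalar, hs]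
  -- Both summands are at most `top`; hence the factor `2` in `Fits`.
  have hlt : D.solution j + D.code j < 2 ^ b := by
    have := D.solution_le_top j
    have := code_lt_top (D := D) hjn hw
    omega
  refine WP.seq (WP.store hb hM (by rwa [hsel]) fun hM₁ => ?_)
  rw [hsel, Expr.eval_zero] at hM₁ ⊢
  set M₁ := M.write 17 0 (D.solution j + D.code j) with hM₁def
  have h₁ : D.Env M₁ := h.congr fun a ha _ => Memory.write_of_ne _ (by omega)
  have hsel₁ : M₁ 17 0 = D.solution j + D.code j := by simp [hM₁def, Memory.write_apply]
  have hj₁ : M₁ 10 0 = j := by simp [hM₁def, Memory.write_apply, hj]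
  have hbv : M₁ 18 0 = (D.best j).1 := by simp [hM₁def, Memory.write_apply, h1]
  have hbc : M₁ 19 0 = (D.best j).2 := by simp [hM₁def, Memory.write_apply, h2]
  have hg : Code.gain.eval M₁ = D.gain j := by
    simp [Code.gain, sel, Code.pow, Code.n, Code.R, Code.pen, Code.j, h₁.n, h₁.R,
      h₁.pow D.n le_rfl, hj₁, h₁.pen j hjn, hsel₁, Data.gain]
  have hcond : (Code.gain - bestValue).eval M₁ = D.gain j - (D.best j).1 := by
    rw [Expr.eval_sub, hg, bestValue, Expr.eval_scalar, hbv]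
  refine WP.branch hb hM₁ (fun he => ?_) (fun he => ?_)
  · rw [hcond] at he
    have hbest : D.best (j + 1) = (D.gain j, D.solution j + D.code j) := by
      rw [best, if_pos ⟨hw, by omega⟩]
    have hgl : D.gain j < 2 ^ b := by
      have h3 := Nat.mod_lt ((D.solution j + D.code j) / 2 ^ D.n) D.R_pos
      have h4 := R_le_top (D := D)
      unfold gain
      omega
    refine WP.seq (WP.store hb hM₁ (by rwa [hg]) fun hM₂ => ?_)
    rw [hg] at hM₂ ⊢
    refine WP.store hb hM₂ ?_ fun _ => ?_
    · simpa [sel, Memory.write_apply, hsel₁] using hlt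
    · rw [hbest]
      simp [sel, Memory.write_apply, hsel₁]
  · rw [hcond] at he
    have hbest : D.best (j + 1) = D.best j := by
      rw [best, if_neg (by omega)]
    exact WP.skip hb hM₁ (by rw [hbest]; exact ⟨hbv, hbc⟩)

theorem wp_search (hF : D.Fits b U) (hM : M.Bounded b) (h : D.Env M)
    (h1 : M 18 0 = 0) (h2 : M 19 0 = 0) :
    WP b U search (fun M' => M' 19 0 = (D.best D.n).2) M := by
  have hb := hF.one_le
  refine (WP.forLoop (N := D.n)
    (fun m M' => M' 18 0 = (D.best m).1 ∧ M' 19 0 = (D.best m).2) hb hF.n_le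
    (hF.n_le.trans_lt hF.U_lt) hM
    (by simp [Code.maxProfit, initTable, fillTable, updateTable, select, Code.compare])
    ?_ ?_ ?_).mono fun _ _ _ h => h.2
  · intro M' hf
    simp only [Code.n, Expr.eval_get, Expr.eval_zero]
    rw [hf 0 (by omega) (by simp [Code.maxProfit, initTable, fillTable, updateTable, select,
      Code.compare]), h.n]
  · simp [Memory.write_apply, best, h1, h2]
  · intro j hj M' hM' hf hi hI
    have h' : D.Env M' := h.congr fun a ha _ => hf a (by omega) (by
      simp [Code.maxProfit, initTable, fillTable, updateTable, select, Code.compare]; omega)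
    have hcond : (Code.c + 1 - Code.w Code.j).eval M' = D.c + 1 - D.w j := by
      simp [Code.c, Code.w, Code.j, h'.c, hi, h'.w j hj]
    refine WP.branch hb hM' (fun he => ?_) (fun he => ?_)
    · have hw : D.w j ≤ D.c := by omega
      refine WP.seq ((wp_maxProfit hF hM' h' hi hj).mono fun M₁ hM₁ hf₁ hI₁ => ?_)
      simp only [Code.maxProfit, Prog.writes_forLoop, Prog.writes_seq, Prog.writes_store, Prog.writes_branch,
        Prog.writes_skip, not_or, not_false_eq_true, and_true] at hf₁
      have h₁ : D.Env M₁ := h'.congr fun a ha _ => hf₁ a (by omega)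
      refine WP.seq ((wp_initTable hF hM₁ h₁ j).mono fun M₂ hM₂ hf₂ hI₂ => ?_)
      simp only [initTable, Prog.writes_forLoop, Prog.writes_seq, Prog.writes_store, not_or] at hf₂
      have h₂ : D.Env M₂ := h₁.congr fun a ha _ => hf₂ a (by omega)
      have hj₂ : M₂ 10 0 = j := by
        rw [hf₂ 10 (by omega), hf₁ 10 (by omega), hi]
      refine WP.seq ((wp_fillTable hF hM₂ h₂ hj₂ hj
        (by rw [hf₂ 11 (by omega), hI₁]) hI₂).mono fun M₃ hM₃ hf₃ hI₃ => ?_)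
      simp only [fillTable, updateTable, Prog.writes_forLoop, Prog.writes_seq, Prog.writes_store, Prog.writes_branch,
        Prog.writes_skip, not_or, not_false_eq_true, and_true] at hf₃
      have h₃ : D.Env M₃ := h₂.congr fun a ha _ => hf₃ a (by omega)
      have hj₃ : M₃ 10 0 = j := by
        rw [hf₃ 10 (by omega), hj₂]
      refine WP.seq ((wp_select hF hM₃ h₃ hj₃ hj hI₃).mono fun M₄ hM₄ hf₄ hI₄ => ?_)
      simp only [select, Prog.writes_forLoop, Prog.writes_seq, Prog.writes_store, Prog.writes_branch,
        Prog.writes_skip, not_or, not_false_eq_true, and_true] at hf₄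
      have h₄ : D.Env M₄ := h₃.congr fun a ha _ => hf₄ a (by omega)
      have hall : ∀ a, 18 ≤ a → M₄ a = M' a := fun a ha => by
        rw [hf₄ a (by omega),
          hf₃ a (by omega),
          hf₂ a (by omega), hf₁ a (by omega)]
      refine (wp_compare hF hM₄ h₄ (by rw [hf₄ 10 (by omega), hj₃]) hj hw hI₄
        (by rw [hall 18 (by omega), hI.1]) (by rw [hall 19 (by omega), hI.2])).mono
        fun M₅ _ _ hI₅ => ?_
      simpa [Memory.write_apply] using hI₅
    · refine WP.skip hb hM' ?_
      have : ¬ (D.w j ≤ D.c ∧ (D.best j).1 < D.gain j) := by omega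
      simp only [Memory.write_apply, best, if_neg this]
      simpa using hI

theorem wp_output (hF : D.Fits b U) (hM : M.Bounded b) (h : D.Env M) {s : ℕ} (hs : M 19 0 = s) :
    WP b U output (fun M' => ∀ i < D.n, M' 4 i = s / 2 ^ i % 2) M := by
  have hb := hF.one_le
  refine WP.forLoop (N := D.n) (fun m M' => ∀ i < m, M' 4 i = s / 2 ^ i % 2) hb hF.n_le
    (hF.n_le.trans_lt hF.U_lt) hM (by simp) ?_ (by simp) ?_
  · intro M' hf
    simp only [Code.n, Expr.eval_get, Expr.eval_zero]
    rw [hf 0 (by omega) (by simp), h.n]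
  · intro m hm M' hM' hf hi hI
    have h' : D.Env M' := h.congr fun a ha ha4 => hf a (by omega) (by simpa)
    have hs' : M' 19 0 = s := by rw [hf 19 (by omega) (by simp), hs]
    have hev : (Expr.rem (bestCode / Code.pow i) 2).eval M' = s / 2 ^ m % 2 := by
      simp [bestCode, Code.pow, i, hs', hi, h'.pow m hm.le]
    refine WP.store hb hM' ?_ fun _ => ?_
    · rw [hev]
      have : 2 ^ 1 ≤ 2 ^ b := Nat.pow_le_pow_right two_pos hb
      omega
    · rw [hev]
      intro v hv
      simp only [Memory.write_apply, i, Expr.eval_scalar, hi]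
      simp only [show ¬ ((4 : ℕ) = 12) by omega, false_and, if_false, true_and]
      split_ifs with hvm
      · rw [hvm]
      · exact hI v (by omega)

theorem wp_init (hF : D.Fits b U) (hM : M.Bounded b) {k d : ℕ} (hn : M 0 0 = D.n)
    (hc : M 0 1 = D.c) (hk : M 0 2 = k) (hK : D.K = k * d) (hp : ∀ i < D.n, M 1 i = D.p i)
    (hw : ∀ i < D.n, M 2 i = D.w i) (hpen : ∀ i < D.n, M 3 i = D.pen i) :
    WP b U (Code.init d) D.Env M := by
  have hb := hF.one_le
  have htop := hF.top_lt
  have hb2 : 1 < 2 ^ b := Nat.one_lt_two_pow (by omega)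
  have hbt : D.base ≤ D.top := Nat.le_mul_of_pos_left _ (by omega)
  refine WP.seq (WP.store hb hM (by simpa using hb2) fun hM₁ => ?_)
  refine WP.seq (WP.store hb hM₁ (by simpa using hb2) fun hM₂ => ?_)
  simp only [Expr.eval_zero, Expr.eval_one] at hM₂ ⊢
  set M₂ := (M.write 5 0 1).write 6 0 1 with hM₂def
  have hf₂ : ∀ a, a ≠ 5 → a ≠ 6 → M₂ a = M a := fun a h1 h2 => by
    rw [hM₂def, Memory.write_of_ne _ h2, Memory.write_of_ne _ h1]
  refine WP.seq ((WP.forLoop (N := D.n) (fun m M' => (∀ l ≤ m, M' 5 l = 2 ^ l) ∧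
    M' 6 0 = 1 + ∑ l ∈ Finset.range m, D.p l) hb hF.n_le
    (hF.n_le.trans_lt hF.U_lt) hM₂ (by simp) ?_ ?_ ?_).mono ?_)
  · intro M' hf
    simp only [Code.n, Expr.eval_get, Expr.eval_zero]
    rw [hf 0 (by omega) (by simp), hf₂ 0 (by omega) (by omega), hn]
  · simp [hM₂def, Memory.write_apply]
  · rintro m hm M' hM' hf hi ⟨hI1, hI2⟩
    have hev : (2 * Code.pow i).eval M' = 2 ^ (m + 1) := by
      simp [Code.pow, i, hi, hI1 m le_rfl, pow_succ, mul_comm]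
    have hi' : (i + 1).eval M' = m + 1 := by simp [i, hi]
    have hlt : 2 ^ (m + 1) < 2 ^ b := by
      have h1 : 2 ^ (m + 1) ≤ 2 ^ D.n := Nat.pow_le_pow_right two_pos hm
      have h2 : 2 ^ D.n ≤ D.base := Nat.le_mul_of_pos_right _ D.R_pos
      omega
    refine WP.seq (WP.store hb hM' (by rwa [hev]) fun hM₃ => ?_)
    rw [hev, hi'] at hM₃ ⊢
    have hev₃ : (Code.R + Code.p i).eval (M'.write 5 (m + 1) (2 ^ (m + 1))) =
        1 + ∑ l ∈ Finset.range (m + 1), D.p l := by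
      have : M' 1 m = D.p m := by
        rw [hf 1 (by omega) (by simp), hf₂ 1 (by omega) (by omega), hp m hm]
      simp [Code.R, Code.p, i, Memory.write_apply, hi, hI2, Finset.sum_range_succ, this, add_assoc]
    refine WP.store hb hM₃ ?_ fun _ => ?_
    · rw [hev₃]
      have h1 : ∑ l ∈ Finset.range (m + 1), D.p l ≤ ∑ l ∈ Finset.range D.n, D.p l :=
        Finset.sum_le_sum_of_subset (Finset.range_subset_range.2 hm)
      have h2 := R_le_top (D := D)
      unfold R at h2
      omega
    · rw [hev₃]
      refine ⟨fun l hl => ?_, by simp [Memory.write_apply]⟩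
      simp only [Memory.write_apply]
      simp only [show ¬ ((5 : ℕ) = 12) by omega, show ¬ ((5 : ℕ) = 6) by omega, false_and, if_false,
        true_and]
      split_ifs with h
      · rw [h]
      · exact hI1 l (by omega)
  · rintro M₃ hM₃ hf₃ ⟨hI1, hI2⟩
    simp only [Prog.writes_forLoop, Prog.writes_seq, Prog.writes_store, not_or] at hf₃
    have hf : ∀ a ≤ 3, M₃ a = M a := fun a ha => by
      rw [hf₃ a (by omega), hf₂ a (by omega) (by omega)]
    have hn₃ : M₃ 0 0 = D.n := by rw [hf 0 (by omega), hn]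
    have hk₃ : M₃ 0 2 = k := by rw [hf 0 (by omega), hk]
    have hNK : (Code.n * (.get 0 2 * .lit d) : Expr).eval M₃ = D.NK := by
      simp [Code.n, hn₃, NK, hK, ← hk₃]
    refine WP.seq (WP.store hb hM₃ (by rw [hNK]; exact hF.NK_lt) fun hM₄ => ?_)
    rw [hNK, Expr.eval_zero] at hM₄ ⊢
    have hV : (Code.n * Code.NK).eval (M₃.write 7 0 D.NK) = D.V := by
      simp [Code.n, Code.NK, Memory.write_apply, hn₃, V]
    refine WP.seq (WP.store hb hM₄ (by rw [hV]; exact hF.V_lt.trans hF.U_lt) fun hM₅ => ?_)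
    rw [hV, Expr.eval_zero] at hM₅ ⊢
    have hB : (Code.pow Code.n * Code.R).eval ((M₃.write 7 0 D.NK).write 8 0 D.V) = D.base := by
      simp [Code.pow, Code.n, Code.R, Memory.write_apply, hn₃, hI1 D.n le_rfl, hI2, base, R]
    refine WP.store hb hM₅ (by rw [hB]; omega) fun _ => ?_
    rw [hB, Expr.eval_zero]
    constructor <;> simp only [Memory.write_apply]
    all_goals simp
    · exact hn₃
    · rw [hf 0 (by omega), hc]
    · rw [hf 1 (by omega)]; exact hp
    · rw [hf 2 (by omega)]; exact hw
    · rw [hf 3 (by omega)]; exact hpen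
    · exact hI1
    · exact hI2

theorem wp_main (hF : D.Fits b U) (hM : M.Bounded b) {k d : ℕ} (hn : M 0 0 = D.n)
    (hc : M 0 1 = D.c) (hk : M 0 2 = k) (hK : D.K = k * d) (hp : ∀ i < D.n, M 1 i = D.p i)
    (hw : ∀ i < D.n, M 2 i = D.w i) (hpen : ∀ i < D.n, M 3 i = D.pen i)
    (h1 : M 18 0 = 0) (h2 : M 19 0 = 0) :
    WP b U (Code.main d) (fun M' => ∀ i < D.n, M' 4 i = (D.best D.n).2 / 2 ^ i % 2) M := by
  refine WP.seq ((wp_init hF hM hn hc hk hK hp hw hpen).mono fun M₁ hM₁ hf₁ hI₁ => ?_)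
  simp only [Code.init, Prog.writes_forLoop, Prog.writes_seq, Prog.writes_store, not_or] at hf₁
  refine WP.seq ((wp_search hF hM₁ hI₁ (by rw [hf₁ 18 (by omega), h1])
    (by rw [hf₁ 19 (by omega), h2])).mono fun M₂ hM₂ hf₂ hI₂ => ?_)
  simp only [search, Code.maxProfit, initTable, fillTable, updateTable, select, Code.compare,
    Prog.writes_forLoop, Prog.writes_seq, Prog.writes_store, Prog.writes_branch,
    Prog.writes_skip, not_or, not_false_eq_true, and_true] at hf₂
  exact wp_output hF hM₂ (hI₁.congr fun a ha _ => hf₂ a (by omega)) hI₂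

end Triples

end Data
/-! ## Approximation guarantee -/

namespace Instance

variable {I : Instance}

theorem value_empty (I : Instance) : I.value ∅ = 0 := by simp [value]

theorem value_insert {j : Fin I.n} {T : Finset (Fin I.n)} (hT : T ⊆ I.rest j) :
    I.value (insert j T) = I.p j + ∑ i ∈ T, (I.p i : ℤ) - I.pen j := by
  have hj : j ∉ T := fun h => by simpa [rest] using hT h
  have h1 : T.sup I.pen ≤ I.pen j := Finset.sup_le fun i hi => by
    have := hT hi
    simp only [rest, Finset.mem_filter, Finset.mem_univ, true_and] at this
    omega
  rw [value, Finset.sum_insert hj, Finset.sup_insert, sup_of_le_left h1]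

/-- Among the items of greatest penalty in `S`, the one of least index precedes all others. -/
theorem exists_leading_item {S : Finset (Fin I.n)} (hS : S.Nonempty) :
    ∃ j ∈ S, S.erase j ⊆ I.rest j := by
  obtain ⟨j₀, hj₀, hmax⟩ := S.exists_max_image I.pen hS
  obtain ⟨j, hj, hmin⟩ := (S.filter fun i => I.pen i = I.pen j₀).exists_min_image id
    ⟨j₀, by simp [hj₀]⟩
  simp only [Finset.mem_filter, id] at hj hmin
  refine ⟨j, hj.1, fun i hi => ?_⟩
  have hi' := Finset.mem_erase.1 hi
  simp only [rest, Finset.mem_filter, Finset.mem_univ, true_and]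
  rcases (hmax i hi'.2).lt_or_eq with h | h
  · exact Or.inl (by omega)
  · exact Or.inr ⟨by omega, lt_of_le_of_ne (hmin i ⟨hi'.2, h⟩) hi'.1.symm⟩

theorem le_kpOpt {items T : Finset (Fin I.n)} {cap : ℕ} (h : I.KPFeasible items cap T) :
    ∑ i ∈ T, I.p i ≤ I.kpOpt items cap :=
  Finset.le_sup (f := fun T => ∑ j ∈ T, I.p j)
    (Finset.mem_filter.2 ⟨Finset.mem_powerset.2 h.1, h.2⟩)

theorem exists_kpOpt (items : Finset (Fin I.n)) (cap : ℕ) :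
    ∃ T, I.KPFeasible items cap T ∧ I.kpOpt items cap = ∑ i ∈ T, I.p i := by
  obtain ⟨T, hT, h⟩ := Finset.exists_mem_eq_sup
    (items.powerset.filter fun T => ∑ j ∈ T, I.w j ≤ cap) ⟨∅, by simp⟩
    (fun T => ∑ j ∈ T, I.p j)
  rw [Finset.mem_filter, Finset.mem_powerset] at hT
  exact ⟨T, hT, h⟩

theorem candidates_feasible {T : Fin I.n → Finset (Fin I.n)}
    (hT : ∀ j, I.w j ≤ I.c → I.KPFeasible (I.rest j) (I.c - I.w j) (T j))
    {S : Finset (Fin I.n)} (hS : S ∈ I.candidates T) : I.Feasible S := by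
  simp only [candidates, Finset.mem_insert, Finset.mem_image, Finset.mem_filter, Finset.mem_univ,
    true_and] at hS
  rcases hS with rfl | ⟨j, hj, rfl⟩
  · simp [Feasible]
  · have hjT : j ∉ T j := fun h => by simpa [rest] using (hT j hj).1 h
    have := (hT j hj).2
    rw [Feasible, Finset.sum_insert hjT]
    omega

/-- Every result of the algorithm is a `(1 - ε)`-approximate solution. -/
theorem IsResultOfA.approx {C : ℝ} (hC : 0 ≤ C) (hI : I.PenaltyExcessLE C) {ε : ℝ} (hε : 0 < ε)
    {S : Finset (Fin I.n)} (hS : I.IsResultOfA (ε / (C + 1)) S) :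
    I.Feasible S ∧ (1 - ε) * (I.opt : ℝ) ≤ (I.value S : ℝ) := by
  obtain ⟨T, hT, hSmem, hmax⟩ := hS
  refine ⟨candidates_feasible (fun j hj => (hT j hj).1) hSmem, ?_⟩
  have hS0 : (0 : ℝ) ≤ I.value S := by
    exact_mod_cast value_empty I ▸ hmax ∅ (by simp [candidates])
  obtain ⟨O, hO, hopt⟩ := Finset.exists_mem_eq_sup' I.feasible_nonempty I.value
  change I.opt = _ at hopt
  rw [Finset.mem_filter] at hO
  have hfeas : ∑ j ∈ O, I.w j ≤ I.c := hO.2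
  have hopt0 : 0 ≤ I.opt := by
    have : I.value ∅ ≤ I.opt := Finset.le_sup' I.value (by simp [Feasible])
    simpa [value] using this
  rcases hopt0.eq_or_lt with h0 | h0
  · rw [← h0]; simpa using hS0
  have hne : O.Nonempty := by
    rw [Finset.nonempty_iff_ne_empty]
    rintro rfl
    rw [hopt] at h0
    simp [value] at h0
  obtain ⟨j, hj, hrest⟩ := exists_leading_item hne
  have hsum := Finset.add_sum_erase O I.w hj
  have hw : I.w j ≤ I.c := by omega
  obtain ⟨hfT, hpT⟩ := hT j hw
  have h1 : I.opt = I.p j + ∑ i ∈ O.erase j, (I.p i : ℤ) - I.pen j := by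
    rw [hopt, ← value_insert hrest, Finset.insert_erase hj]
  have h2 : ∑ i ∈ O.erase j, I.p i ≤ I.kpOpt (I.rest j) (I.c - I.w j) :=
    le_kpOpt ⟨hrest, by omega⟩
  have h3 : I.p j + ∑ i ∈ T j, (I.p i : ℤ) - I.pen j ≤ I.value S := by
    rw [← value_insert hfT.1]
    refine hmax _ ?_
    simp only [candidates, Finset.mem_insert, Finset.mem_image, Finset.mem_filter,
      Finset.mem_univ, true_and]
    exact Or.inr ⟨j, hw, rfl⟩
  obtain ⟨X, hX, hXopt⟩ := I.exists_kpOpt (I.rest j) (I.c - I.w j)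
  have hjX : j ∉ X := fun h => by simpa [rest] using hX.1 h
  -- Adding `j` to an optimal solution of the residual problem gives a feasible set for PKP.
  have h4 : I.p j + (I.kpOpt (I.rest j) (I.c - I.w j) : ℤ) - I.pen j ≤ I.opt := by
    have : I.value (insert j X) ≤ I.opt := by
      refine Finset.le_sup' I.value ?_
      have := hX.2
      simp only [Finset.mem_filter, Finset.mem_univ, true_and, Feasible]
      rw [Finset.sum_insert hjX]
      omega
    rw [value_insert hX.1] at this
    rw [hXopt]
    push_cast
    exact this
  generalize I.kpOpt (I.rest j) (I.c - I.w j) = z at *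
  have h1' : (I.opt : ℝ) = I.p j + ∑ i ∈ O.erase j, (I.p i : ℝ) - I.pen j := by exact_mod_cast h1
  have h2' : ∑ i ∈ O.erase j, (I.p i : ℝ) ≤ z := by exact_mod_cast h2
  have h3' : I.p j + ∑ i ∈ T j, (I.p i : ℝ) - I.pen j ≤ I.value S := by exact_mod_cast h3
  have h4' : I.p j + (z : ℝ) - I.pen j ≤ I.opt := by exact_mod_cast h4
  have h5 : (1 : ℝ) ≤ I.opt := by exact_mod_cast h0
  have h6 := hI j
  -- Here `z ≤ z* + C ≤ (C + 1) z*`: the integrality of the optimum (`h5`) turns the additive error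
  -- into a factor.
  have h7 : (z : ℝ) ≤ (C + 1) * I.opt := by nlinarith
  have h8 : ε / (C + 1) * z ≤ ε * I.opt := by
    rw [div_mul_eq_mul_div, div_le_iff₀ (by linarith)]
    nlinarith
  linarith

/-! ### From items in `Fin n` to items in `ℕ` -/

/-- The data of the instance as functions on `ℕ`, with accuracy parameter `K`. -/
def toData (I : Instance) (K : ℕ) : Data where
  n := I.n
  c := I.c
  K := K
  p := vecArray I.p
  w := vecArray I.w
  pen := vecArray I.pen

theorem vecArray_fin {n : ℕ} (f : Fin n → ℕ) (i : Fin n) : vecArray f i = f i := by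
  simp [vecArray]

theorem sum_map_vecArray {n : ℕ} (f : Fin n → ℕ) (S : Finset (Fin n)) :
    ∑ i ∈ S.map Fin.valEmbedding, vecArray f i = ∑ i ∈ S, f i := by
  simp [vecArray_fin]

theorem map_subset_range {n : ℕ} (S : Finset (Fin n)) :
    S.map Fin.valEmbedding ⊆ Finset.range n := by
  intro i
  simp only [Finset.mem_map, Fin.valEmbedding_apply, Finset.mem_range]
  rintro ⟨i, -, rfl⟩
  exact i.2

theorem exists_eq_map {n : ℕ} {S : Finset ℕ} (hS : S ⊆ Finset.range n) :
    ∃ S' : Finset (Fin n), S'.map Fin.valEmbedding = S := by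
  refine ⟨Finset.univ.filter fun i => (i : ℕ) ∈ S, ?_⟩
  ext i
  simp only [Finset.mem_map, Finset.mem_filter, Finset.mem_univ, true_and, Fin.valEmbedding_apply]
  exact ⟨fun ⟨i, h, e⟩ => e ▸ h, fun h => ⟨⟨i, Finset.mem_range.1 (hS h)⟩, h, rfl⟩⟩

theorem toData_eligible (K : ℕ) (i j : Fin I.n) (hj : I.w j ≤ I.c) :
    (I.toData K).Eligible j i ↔ i ∈ I.rest j ∧ I.w i ≤ I.c - I.w j := by
  simp only [Data.Eligible, toData, vecArray_fin, rest, Finset.mem_filter, Finset.mem_univ,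
    true_and, Fin.lt_def]
  refine and_congr ?_ (by omega)
  split_ifs <;> omega

theorem map_subset_eligible (K : ℕ) {j : Fin I.n} (hj : I.w j ≤ I.c) (S : Finset (Fin I.n)) :
    S.map Fin.valEmbedding ⊆ (Finset.range I.n).filter ((I.toData K).Eligible j) ↔
      ∀ i ∈ S, i ∈ I.rest j ∧ I.w i ≤ I.c - I.w j := by
  simp only [Finset.subset_iff, Finset.mem_map, Finset.mem_filter, Finset.mem_range,
    Fin.valEmbedding_apply]
  constructor
  · intro h i hi
    exact (toData_eligible K i j hj).1 (h ⟨i, hi, rfl⟩).2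
  · rintro h _ ⟨i, hi, rfl⟩
    exact ⟨i.2, (toData_eligible K i j hj).2 (h i hi)⟩

theorem exists_approx {K : ℕ} (hK : 0 < K) {δ : ℝ} (hδ : 1 ≤ δ * K) (j : Fin I.n)
    (hj : I.w j ≤ I.c) : ∃ T : Finset (Fin I.n), I.KPFeasible (I.rest j) (I.c - I.w j) T ∧
      (1 - δ) * (I.kpOpt (I.rest j) (I.c - I.w j) : ℝ) ≤ ∑ i ∈ T, (I.p i : ℝ) ∧
      ∑ i ∈ T.map Fin.valEmbedding, (I.toData K).code i = (I.toData K).solution j := by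
  have hj' : (I.toData K).w j ≤ (I.toData K).c := by simpa [toData, vecArray_fin] using hj
  obtain ⟨T, hT, hcode, hTw, hTp⟩ := Data.exists_solution hj'
  obtain ⟨T, rfl⟩ := exists_eq_map (n := I.n) (hT.trans (Finset.filter_subset _ _))
  change _ ≤ I.c - vecArray I.w j at hTw
  simp only [toData, vecArray_fin, sum_map_vecArray] at hTw hTp
  have hT' := (map_subset_eligible K hj T).1 hT
  refine ⟨T, ⟨fun i hi => (hT' i hi).1, hTw⟩, ?_, hcode⟩
  obtain ⟨X, hX, hXopt⟩ := I.exists_kpOpt (I.rest j) (I.c - I.w j)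
  -- An optimal solution `X` consists of eligible items, since each of its items fits alone. As `S'`
  -- is feasible too, `K z ≤ K p(T) + z`, and `1 ≤ δ K` finishes.
  obtain ⟨S', hS', hS'w, h⟩ := hTp (X.map Fin.valEmbedding)
    ((map_subset_eligible K hj X).2 fun i hi =>
      ⟨hX.1 hi, (Finset.single_le_sum (fun _ _ => Nat.zero_le _) hi).trans hX.2⟩)
    (by rw [sum_map_vecArray]; exact hX.2)
  obtain ⟨S', rfl⟩ := exists_eq_map (hS'.trans (Finset.filter_subset _ _))
  rw [sum_map_vecArray] at hS'w
  simp only [sum_map_vecArray] at h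
  have h1 := le_kpOpt ⟨fun i hi => ((map_subset_eligible K hj S').1 hS' i hi).1, hS'w⟩
  rw [← hXopt] at h
  have h2 : (K : ℝ) * I.kpOpt (I.rest j) (I.c - I.w j) ≤
      K * ∑ i ∈ T, (I.p i : ℝ) + I.kpOpt (I.rest j) (I.c - I.w j) := by
    exact_mod_cast h.trans (Nat.add_le_add_left h1 _)
  have hK' : (0 : ℝ) < K := by exact_mod_cast hK
  refine le_of_mul_le_mul_left ?_ hK'
  have h3 : (0 : ℝ) ≤ I.kpOpt (I.rest j) (I.c - I.w j) := by positivity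
  nlinarith

/-- The set whose code is selected by the program is a result of the algorithm. -/
theorem exists_best {K : ℕ} (hK : 0 < K) {δ : ℝ} (hδ : 1 ≤ δ * K) :
    ∃ S, I.IsResultOfA δ S ∧
      ∑ i ∈ S.map Fin.valEmbedding, (I.toData K).code i = ((I.toData K).best I.n).2 := by
  have hex := fun j : Fin I.n => fun hj => exists_approx hK hδ j hj
  choose! T hT hTp hTc using hex
  set D := I.toData K with hD
  have hcand : ∀ j, I.w j ≤ I.c → insert j (T j) ∈ I.candidates T := fun j hj => by
    simp only [candidates, Finset.mem_insert, Finset.mem_image, Finset.mem_filter,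
      Finset.mem_univ, true_and]
    exact Or.inr ⟨j, hj, rfl⟩
  -- The running best is always attained by a candidate: it starts with the empty set and changes
  -- only for a gain above a value at least `0`, which is not truncated.
  have main : ∀ m ≤ I.n, ∃ S ∈ I.candidates T, I.value S = (D.best m).1 ∧
      ∑ i ∈ S.map Fin.valEmbedding, D.code i = (D.best m).2 ∧
      ∀ j : Fin I.n, (j : ℕ) < m → I.w j ≤ I.c → I.value (insert j (T j)) ≤ (D.best m).1 := by
    intro m
    induction m with
    | zero =>
      intro _
      exact ⟨∅, by simp [candidates], by simp [value, Data.best], by simp [Data.best],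
        by simp⟩
    | succ m ih =>
      intro hm
      obtain ⟨S, hS, h1, h2, h3⟩ := ih (by omega)
      have hwm : D.w m = I.w ⟨m, hm⟩ := vecArray_fin I.w ⟨m, hm⟩
      have hgain : I.w ⟨m, hm⟩ ≤ I.c →
          ∑ i ∈ (insert ⟨m, hm⟩ (T ⟨m, hm⟩)).map Fin.valEmbedding, D.code i =
            D.solution m + D.code m ∧
          (D.gain m : ℤ) = max (I.value (insert ⟨m, hm⟩ (T ⟨m, hm⟩))) 0 := by
        intro hj
        have hmem : (⟨m, hm⟩ : Fin I.n) ∉ T ⟨m, hm⟩ := fun h => by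
          simpa [rest] using (hT _ hj).1 h
        have hsum : ∑ i ∈ (insert ⟨m, hm⟩ (T ⟨m, hm⟩)).map Fin.valEmbedding, D.code i =
            D.solution m + D.code m := by
          rw [← hTc _ hj, Finset.sum_map, Finset.sum_map, Finset.sum_insert hmem, Nat.add_comm]
          rfl
        refine ⟨hsum, ?_⟩
        have hp := Data.sum_code_profit (D := D) (map_subset_range (insert ⟨m, hm⟩ (T ⟨m, hm⟩)))
        have hpen : D.pen m = I.pen ⟨m, hm⟩ := vecArray_fin I.pen ⟨m, hm⟩
        rw [Data.gain, ← hsum, hp, hpen, value_insert (hT _ hj).1]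
        simp only [hD, toData, sum_map_vecArray]
        rw [Finset.sum_insert hmem, ← Nat.cast_sum]
        omega
      by_cases h : D.w m ≤ D.c ∧ (D.best m).1 < D.gain m
      · have hj : I.w ⟨m, hm⟩ ≤ I.c := hwm ▸ h.1
        obtain ⟨h4, h5⟩ := hgain hj
        simp only [Data.best, if_pos h]
        refine ⟨_, hcand ⟨m, hm⟩ hj, by omega, h4, fun j hjm hjw => ?_⟩
        rcases Nat.lt_succ_iff_lt_or_eq.1 hjm with h6 | h6
        · have := h3 j h6 hjw
          omega
        · obtain rfl : j = ⟨m, hm⟩ := Fin.ext h6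
          omega
      · simp only [Data.best, if_neg h]
        refine ⟨S, hS, h1, h2, fun j hjm hjw => ?_⟩
        rcases Nat.lt_succ_iff_lt_or_eq.1 hjm with h6 | h6
        · exact h3 j h6 hjw
        · obtain rfl : j = ⟨m, hm⟩ := Fin.ext h6
          have h5 := (hgain hjw).2
          have : ¬ (D.best m).1 < D.gain m := fun h' => h ⟨by rw [hwm]; exact hjw, h'⟩
          omega
  obtain ⟨S, hS, h1, h2, h3⟩ := main I.n le_rfl
  refine ⟨S, ⟨T, fun j hj => ⟨hT j hj, hTp j hj⟩, hS, fun S' hS' => ?_⟩, h2⟩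
  simp only [candidates, Finset.mem_insert, Finset.mem_image, Finset.mem_filter, Finset.mem_univ,
    true_and] at hS'
  rcases hS' with rfl | ⟨j, hj, rfl⟩
  · rw [h1]
    simp [value]
  · rw [h1]
    exact h3 j j.2 hj

/-! ## Running time -/

/-- By `1 + s + x ≤ (1 + s) * (1 + x)`, the total profit needs no more bits than the single profits
together. -/
theorem one_add_sum_le {n : ℕ} (f : ℕ → ℕ) :
    1 + ∑ i ∈ Finset.range n, f i ≤ 2 ^ ∑ i ∈ Finset.range n, (f i).size := by
  induction n with
  | zero => simp
  | succ n ih =>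
    rw [Finset.sum_range_succ, Finset.sum_range_succ, pow_add]
    have h1 : f n + 1 ≤ 2 ^ (f n).size := Nat.lt_size_self _
    calc _ ≤ (1 + ∑ i ∈ Finset.range n, f i) * (f n + 1) := by
          nlinarith [Nat.zero_le ((∑ i ∈ Finset.range n, f i) * f n)]
      _ ≤ _ := Nat.mul_le_mul ih h1

theorem top_bound (K : ℕ) : 2 * (I.toData K).top ≤ 2 ^ I.length := by
  have h1 : I.c + 1 ≤ 2 ^ I.c.size := Nat.lt_size_self _
  have h2 := one_add_sum_le (n := I.n) (vecArray I.p)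
  have h3 : ∑ i ∈ Finset.range I.n, (vecArray I.p i).size = ∑ j, (I.p j).size := by
    rw [Finset.sum_range]
    simp [vecArray_fin]
  -- The separators counted in the encoding pay for the factors `2` and `2 ^ n`.
  have h4 : 1 + I.c.size + (I.n + ∑ j, (I.p j).size) ≤ I.length := by
    simp only [length, Finset.sum_add_distrib, Finset.sum_const, Finset.card_univ, Fintype.card_fin,
      smul_eq_mul, mul_one]
    omega
  rw [h3] at h2
  calc 2 * (I.toData K).top = 2 * (I.c + 1) * (2 ^ I.n * (1 + ∑ i ∈ Finset.range I.n,
        vecArray I.p i)) := by simp only [Data.top, Data.base, Data.R, toData]; ring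
    _ ≤ 2 * 2 ^ I.c.size * (2 ^ I.n * 2 ^ ∑ j, (I.p j).size) := by gcongr
    _ = 2 ^ (1 + I.c.size + (I.n + ∑ j, (I.p j).size)) := by ring
    _ ≤ _ := Nat.pow_le_pow_right two_pos h4

theorem n_le_length : I.n ≤ I.length := by
  simp only [length, Finset.sum_add_distrib, Finset.sum_const, Finset.card_univ, Fintype.card_fin,
    smul_eq_mul, mul_one]
  omega

theorem one_le_length : 1 ≤ I.length := by
  simp only [length]
  omega

theorem item_size_le_length (j : Fin I.n) :
    (I.p j).size ≤ I.length ∧ (I.w j).size ≤ I.length ∧ (I.pen j).size ≤ I.length := by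
  have := Finset.single_le_sum (f := fun j => (I.p j).size + 1 + ((I.w j).size + 1) +
    ((I.pen j).size + 1)) (fun _ _ => Nat.zero_le _) (Finset.mem_univ j)
  simp only [length]
  omega

/-- A bound on the number of rounds of each loop. -/
def rounds (I : Instance) (K : ℕ) : ℕ := (I.toData K).V + I.n + 1

/-- A bound on the number of bits of the numbers in memory. -/
def bits (I : Instance) (k K : ℕ) : ℕ := I.length + I.rounds K + k

/-- Taking the number of rounds itself as a number of bits is wasteful but still polynomial, and
then `x < 2 ^ x` suffices. -/
theorem fits (k K : ℕ) : (I.toData K).Fits (I.bits k K) (I.rounds K) := by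
  have hpow : I.rounds K < 2 ^ I.bits k K :=
    Nat.lt_two_pow_self.trans_le (Nat.pow_le_pow_right two_pos (by simp only [bits]; omega))
  refine ⟨?_, ?_, ?_, hpow, ?_, ?_⟩
  · simp only [bits, rounds]; omega
  · simp only [rounds, toData]; omega
  · simp only [rounds]; omega
  · refine lt_of_le_of_lt ?_ hpow
    rcases Nat.eq_zero_or_pos (I.toData K).n with h | h
    · simp [Data.NK, h]
    · have : (I.toData K).NK ≤ (I.toData K).V := Nat.le_mul_of_pos_left _ h
      simp only [rounds]
      omega
  · refine (top_bound K).trans_lt (Nat.pow_lt_pow_right one_lt_two ?_)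
    simp only [bits, rounds]
    omega

theorem inputMemory_bounded (k K : ℕ) : (inputMemory I k).Bounded (I.bits k K) := by
  have hpos : 0 < 2 ^ I.bits k K := by positivity
  have hvec : ∀ {n : ℕ} (f : Fin n → ℕ), (∀ j, f j < 2 ^ I.bits k K) →
      ∀ i, vecArray f i < 2 ^ I.bits k K := by
    intro n f hf i
    unfold vecArray
    split_ifs
    · exact hf _
    · exact hpos
  have hsize : ∀ x : ℕ, x.size ≤ I.length → x < 2 ^ I.bits k K := fun x hx =>
    Nat.size_le.1 (hx.trans (by simp only [bits]; omega))
  have hsmall : ∀ x ≤ I.bits k K, x < 2 ^ I.bits k K := fun x hx =>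
    hx.trans_lt Nat.lt_two_pow_self
  intro a i
  unfold inputMemory
  split
  · refine hvec _ (fun j => ?_) i
    fin_cases j
    · exact hsmall _ (by simp only [bits, rounds]; simp; omega)
    · refine hsize _ ?_
      simp only [length]
      simp
      omega
    · exact hsmall _ (by simp only [bits]; simp)
  · exact hvec _ (fun j => hsize _ (item_size_le_length j).1) i
  · exact hvec _ (fun j => hsize _ (item_size_le_length j).2.1) i
  · exact hvec _ (fun j => hsize _ (item_size_le_length j).2.2) i
  · exact hpos

/-- The program outputs a result of the algorithm. -/
theorem exists_outputs (I : Instance) {k d : ℕ} (hK : 0 < k * d) {δ : ℝ}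
    (hδ : 1 ≤ δ * (k * d : ℕ)) : ∃ t S, Outputs (Code.main d) I k t S ∧
      t ≤ (Code.main d).bound (I.rounds (k * d)) * I.bits k (k * d) ∧ I.IsResultOfA δ S := by
  obtain ⟨S, hS, hcode⟩ := I.exists_best hK hδ
  obtain ⟨t, M, h1, h2, -, h3⟩ := Data.wp_main (I.fits k (k * d)) (I.inputMemory_bounded k (k * d))
    (k := k) (d := d) (by simp [inputMemory, vecArray, toData])
    (by simp [inputMemory, vecArray, toData]) (by simp [inputMemory, vecArray])
    rfl (fun _ _ => rfl) (fun _ _ => rfl) (fun _ _ => rfl) rfl rfl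
  refine ⟨t, S, ⟨M, h1, fun j => ?_⟩, h2, hS⟩
  have h4 := h3 j j.2
  change M 4 j = ((I.toData (k * d)).best I.n).2 / _ % 2 at h4
  rw [h4, ← hcode, Data.sum_code_mem (show (j : ℕ) < (I.toData (k * d)).n from j.2)]
  simp [Fin.val_inj]

end Instance

/-! ### Uniqueness of the output and the polynomial time bound -/

theorem Outputs.unique {P : Prog} {I : Instance} {k t t' : ℕ} {S S' : Finset (Fin I.n)}
    (h : Outputs P I k t S) (h' : Outputs P I k t' S') : S = S' := by
  obtain ⟨M, h1, h2⟩ := h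
  obtain ⟨M', h1', h2'⟩ := h'
  obtain ⟨-, rfl⟩ := h1.det h1'
  ext j
  have := (h2 j).symm.trans (h2' j)
  split_ifs at this <;> simp_all

theorem exists_time_bound (d : ℕ) : ∃ a e : ℕ, ∀ (I : Instance) (k : ℕ),
    (Code.main d).bound (I.rounds (k * d)) * I.bits k (k * d) ≤ a * (I.length + k) ^ e := by
  generalize Code.main d = P
  -- As `V = n * (n * (k * d))`, rounds and bits are cubic in `N = length + k`; the cube enters
  -- `P.depth` times through the rounds and once through the bits.
  refine ⟨P.bound 1 * (d + 2) ^ P.depth * (d + 4), 3 * P.depth + 3, fun I k => ?_⟩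
  set N := I.length + k with hN
  have h1 := I.one_le_length
  have hn := I.n_le_length
  have hN1 : 1 ≤ N := by omega
  have hN3 : N ≤ N ^ 3 := Nat.le_self_pow (by norm_num) _
  have hU : I.rounds (k * d) ≤ (d + 2) * N ^ 3 := by
    have : (I.toData (k * d)).V ≤ d * N ^ 3 := by
      calc (I.toData (k * d)).V = I.n * (I.n * (k * d)) := rfl
        _ ≤ N * (N * (N * d)) := by gcongr <;> omega
        _ = _ := by ring
    simp only [Instance.rounds, add_mul]
    omega
  have hb : I.bits k (k * d) ≤ (d + 4) * N ^ 3 := by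
    simp only [Instance.bits]
    have : (d + 4) * N ^ 3 = (d + 2) * N ^ 3 + 2 * N ^ 3 := by ring
    omega
  calc _ ≤ P.bound 1 * I.rounds (k * d) ^ P.depth * I.bits k (k * d) := by
        gcongr
        exact Prog.bound_le _ (by simp only [Instance.rounds]; omega)
    _ ≤ P.bound 1 * ((d + 2) * N ^ 3) ^ P.depth * ((d + 4) * N ^ 3) := by
        gcongr
    _ = _ := by rw [mul_pow, ← pow_mul, pow_add]; ring

end PKP

/-- Let `C ≥ 0` and consider the instances with `π_j - p_j ≤ C` for all items `j`. Every result of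
`A(ε / (C + 1))` is a `(1 - ε)`-approximate solution, and there is a program that is an FPTAS on
these instances and realizes `A(ε / (C + 1))`. -/
theorem mainTheorem10 (C : ℝ) (hC : 0 ≤ C) :
    (∀ I : PKP.Instance, I.PenaltyExcessLE C → ∀ ε : ℝ, 0 < ε → ε < 1 →
      ∀ S : Finset (Fin I.n), I.IsResultOfA (ε / (C + 1)) S →
        I.Feasible S ∧ (1 - ε) * (I.opt : ℝ) ≤ (I.value S : ℝ)) ∧
    ∃ P : PKP.Prog,
      PKP.IsFPTAS P (fun I => I.PenaltyExcessLE C) ∧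
      ∀ I : PKP.Instance, I.PenaltyExcessLE C → ∀ ε : ℝ, 0 < ε → ε < 1 →
        ∀ (t : ℕ) (S : Finset (Fin I.n)), PKP.Outputs P I ⌈1 / ε⌉₊ t S →
          I.IsResultOfA (ε / (C + 1)) S := by
  refine ⟨fun I hI ε hε _ S hS => hS.approx hC hI hε, ?_⟩
  -- A constant of the program, so only `⌈1 / ε⌉` need be supplied: `d ≥ C + 1` makes `K = ⌈1 / ε⌉ *
  -- d` at least `(C + 1) / ε`.
  set d := ⌈C⌉₊ + 1 with hd
  have hdC : C + 1 ≤ d := by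
    rw [hd]
    push_cast
    linarith [Nat.le_ceil C]
  have run : ∀ (I : PKP.Instance) (ε : ℝ), 0 < ε → ∃ t S,
      PKP.Outputs (PKP.Code.main d) I ⌈1 / ε⌉₊ t S ∧
      t ≤ (PKP.Code.main d).bound (I.rounds (⌈1 / ε⌉₊ * d)) * I.bits ⌈1 / ε⌉₊ (⌈1 / ε⌉₊ * d) ∧
      I.IsResultOfA (ε / (C + 1)) S := by
    intro I ε hε
    have hk : 1 ≤ ε * ⌈1 / ε⌉₊ := by
      have := Nat.le_ceil (1 / ε)
      rwa [div_le_iff₀' hε] at this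
    refine I.exists_outputs (Nat.mul_pos (Nat.ceil_pos.2 (by positivity)) (by omega)) ?_
    rw [div_mul_eq_mul_div, le_div_iff₀ (by linarith)]
    push_cast
    nlinarith
  obtain ⟨a, e, hae⟩ := PKP.exists_time_bound d
  refine ⟨PKP.Code.main d, ⟨a * 2 ^ e, e, ?_⟩, ?_⟩
  · intro I hI ε hε hε1
    obtain ⟨t, S, h1, h2, h3⟩ := run I ε hε
    refine ⟨t, S, h1, ?_, h3.approx hC hI hε⟩
    -- Since `1 / ε ≥ 1`, rounding up at most doubles it; this is the source of `2 ^ e`.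
    have hN : ((I.length + ⌈1 / ε⌉₊ : ℕ) : ℝ) ≤ 2 * (I.length + 1 / ε) := by
      have h4 : 1 ≤ 1 / ε := by rw [le_div_iff₀ hε]; linarith
      have h5 := (Nat.ceil_lt_add_one (by positivity : 0 ≤ 1 / ε)).le
      have h6 : (0 : ℝ) ≤ I.length := by positivity
      push_cast
      linarith
    calc (t : ℝ) ≤ ((a * (I.length + ⌈1 / ε⌉₊) ^ e : ℕ) : ℝ) := by
          exact_mod_cast h2.trans (hae I _)
      _ = a * ((I.length + ⌈1 / ε⌉₊ : ℕ) : ℝ) ^ e := by push_cast; ring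
      _ ≤ a * (2 * (I.length + 1 / ε)) ^ e := by gcongr
      _ = _ := by rw [mul_pow]; push_cast; ring
  · intro I _ ε hε _ t S hS
    obtain ⟨t', S', h1, _, h3⟩ := run I ε hε
    rwa [hS.unique h1]
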